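/- **Conventions.** C*-algebras and $*$-homomorphisms are unital. A C*-algebra is a $\sigma C^*$-algebra if every norm-bounded increasing sequence of self-adjoint elements has a supremum among the self-adjoint elements. A positive unital map is $\sigma$-normal if it preserves all existing suprema of bounded increasing sequences of self-adjoint elements; $\sigma$-cpu means completely positive, unital and $\sigma$-normal. A $\sigma C^*$-algebra $\mathcal A$ is purely $\sigma$-representable if a positive $x\in\mathcal A$ is $0$ as soon as $\phi(x)=0$ for all pure $\sigma$-states $\phi$ (the $\sigma$-normal states that are extremal among all states). Let $\mathsf C$ be the category of commutative purely $\sigma$-representable $\sigma C^*$-algebras and $\sigma$-cpu maps, and let $\mathsf{Stoch}$ be the category of measurable spaces and Markov kernels, with its symmetric monoidal structure $\times$ given by products of measurable spaces. For a measurable space $X$ let $\mathscr L^\infty(X)$ be the algebra of bounded measurable functions $X\to\mathbb C$; a Markov kernel $\mu\colon X\rightsquigarrow Y$ acts by $\mathscr L^\infty(\mu)(f)(x)=\int_Y f(y)\,\mathrm d\mu(y|x)$. For $\mathcal A\in\mathsf C$ let $\mathrm{Spec}_\sigma(\mathcal A)$ be the set of $\sigma$-normal $*$-homomorphisms $\mathcal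 A\to\mathbb C$ with the smallest $\sigma$-algebra making all evaluations $\phi\mapsto\phi(a)$ measurable. The regular tensor product $\mathcal A\otimes^r\mathcal B$ is the regular $\sigma$-completion of the C*-tensor product $\mathcal A\otimes\mathcal B$ (the coproduct of commutative C*-algebras): a $\sigma C^*$-algebra with an injective $\sigma$-normal $*$-homomorphism $j$ from $\mathcal A\otimes\mathcal B$, such that it is the smallest $*$-subspace of itself that contains the range of $j$ and is closed under suprema of bounded increasing sequences, and such that every self-adjoint $b$ is the supremum of $\{j(t)\mid j(t)\le b\}$. **Proposition.** The functor $\mathscr L^\infty\colon\mathsf{Stoch}\to\mathsf C^{\mathrm{op}}$ is an equivalence. Its inverse is a functor $\mathrm{Spec}_\sigma$, given on objects by the above and sending a $\sigma$-cpu map $f\colon\mathcal A\to\mathcal B$ to a Markov kernel $\mathrm{Spec}_\sigma(\mathcal B)\rightsquigarrow\mathrm{Spec}_\sigma(\mathcal A)$ with $\int\phi(a)\,\mathrm d(\mathrm{Spec}_\sigma f)(\phi|\psi)=\psi(f(a))$; the unit is $x\mapsto\delta_{\mathrm{ev}_x}$, and the counit corresponds to the maps $\mathcal A\to\mathscr L^\infty(\mathrm{Spec}_\sigma(\mathcal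 A))$, $a\mapsto(\phi\mapsto\phi(a))$. Moreover, $\mathsf C$ has a symmetric monoidal structure whose tensor product is $\otimes^r$ on objects, whose unit is $\mathbb C$, with $(f\otimes g)(a\otimes b)=f(a)\otimes g(b)$ for all $\sigma$-cpu maps $f,g$, and with the canonical associators, unitors and braiding on elementary tensors. For this structure, $\mathscr L^\infty$ and $\mathrm{Spec}_\sigma$ form a symmetric monoidal equivalence $$(\mathsf{Stoch},\times)\;\simeq\;(\mathsf C,\otimes^r)^{\mathrm{op}},$$ where $\mathscr L^\infty(X)\otimes^r\mathscr L^\infty(Y)\cong\mathscr L^\infty(X\times Y)$ sends $f\otimes g$ to $(x,y)\mapsto f(x)g(y)$. Finally, $\mathsf C^{\mathrm{op}}$ is a Markov category whose copy and discard morphisms are given by the multiplications $\mathcal A\otimes^r\mathcal A\to\mathcal A$, $a\otimes b\mapsto ab$, and the units $\mathbb C\to\mathcal A$, and the above is an equivalence of Markov categories: $\mathscr L^\infty$ takes the copy and discard morphisms of $\mathsf{Stoch}$ to those of $\mathsf C^{\mathrm{op}}$. -/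

import Mathlib

open CategoryTheory MonoidalCategory ProbabilityTheory MeasureTheory
open scoped ComplexOrder CStarAlgebra ENNReal

universe u

namespace SigmaCStar

/-! ### Monotone σ-complete C⋆-algebras and σ-normal maps -/

/-- `a` is a norm-bounded, monotone increasing sequence of self-adjoint elements. -/
structure IsBddMonoSeq {A : Type*} [CStarAlgebra A] [PartialOrder A] (a : ℕ → A) : Prop where
  isSelfAdjoint : ∀ n, IsSelfAdjoint (a n)
  monotone : Monotone a
  bounded : ∃ r : ℝ, ∀ n, ‖a n‖ ≤ r

/-- A C⋆-algebra is a `σC⋆`-algebra if bounded monotone increasing sequences of self-adjoint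
elements have suprema.  (An upper bound of a self-adjoint element is self-adjoint, so least upper
bounds of nonempty families of self-adjoint elements are the same in `A` and in the poset of
self-adjoint elements.) -/
def IsSigmaComplete (A : Type*) [CStarAlgebra A] [PartialOrder A] : Prop :=
  ∀ a : ℕ → A, IsBddMonoSeq a → ∃ s, IsLUB (Set.range a) s

/-- A map is `σ`-normal if it preserves all existing suprema of bounded monotone increasing
sequences of self-adjoint elements. -/
def SigmaNormal {A B : Type*} [CStarAlgebra A] [PartialOrder A] [CStarAlgebra B] [PartialOrder B]
    (φ : A → B) : Prop :=
  ∀ (a : ℕ → A) (s : A), IsBddMonoSeq a → IsLUB (Set.range a) s →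
    IsLUB (Set.range fun n => φ (a n)) (φ s)

/-- The states: positive unital linear functionals. -/
def states (A : Type*) [CStarAlgebra A] [PartialOrder A] : Set (A →ₗ[ℂ] ℂ) :=
  {φ | (∀ a, 0 ≤ a → 0 ≤ φ a) ∧ φ 1 = 1}

/-- A pure `σ`-state: a `σ`-normal state that is extremal in the convex set of all states. -/
def IsPureSigmaState {A : Type*} [CStarAlgebra A] [PartialOrder A] (φ : A →ₗ[ℂ] ℂ) : Prop :=
  φ ∈ Set.extremePoints ℝ (states A) ∧ SigmaNormal φ

/-- Pure `σ`-states separate the positive elements from `0`. -/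
def IsPurelySigmaRepresentable (A : Type*) [CStarAlgebra A] [PartialOrder A] : Prop :=
  ∀ x : A, 0 ≤ x → (∀ φ : A →ₗ[ℂ] ℂ, IsPureSigmaState φ → φ x = 0) → x = 0

/-- `σ`-cpu maps: completely positive, unital, `σ`-normal maps. -/
structure SigmaCPU (A B : Type*) [CStarAlgebra A] [PartialOrder A] [StarOrderedRing A]
    [CStarAlgebra B] [PartialOrder B] [StarOrderedRing B] extends CompletelyPositiveMap A B where
  map_one' : toFun 1 = 1
  sigmaNormal' : SigmaNormal toFun

namespace SigmaCPU

variable {A B C : Type*} [CStarAlgebra A] [PartialOrder A] [StarOrderedRing A]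
  [CStarAlgebra B] [PartialOrder B] [StarOrderedRing B]
  [CStarAlgebra C] [PartialOrder C] [StarOrderedRing C]

instance : FunLike (SigmaCPU A B) A B where
  coe f := f.toFun
  coe_injective f g h := by
    rcases f with ⟨f, _, _⟩
    rcases g with ⟨g, _, _⟩
    have : f = g := DFunLike.coe_injective h
    subst this
    rfl

@[ext]
lemma ext {f g : SigmaCPU A B} (h : ∀ a, f a = g a) : f = g := DFunLike.ext _ _ h

lemma monotone (f : SigmaCPU A B) : Monotone f :=
  OrderHomClass.mono f.toCompletelyPositiveMap

/-- The underlying positive linear map. -/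
noncomputable def toPositive (f : SigmaCPU A B) : A →ₚ[ℂ] B :=
  { f.toLinearMap with monotone' := f.monotone }

lemma isBddMonoSeq (f : SigmaCPU A B) {a : ℕ → A} (ha : IsBddMonoSeq a) :
    IsBddMonoSeq fun n => f (a n) where
  isSelfAdjoint n := (ha.isSelfAdjoint n).map' f.toPositive
  monotone := fun m n h => f.monotone (ha.monotone h)
  bounded := by
    obtain ⟨r, hr⟩ := ha.bounded
    obtain ⟨c, hc⟩ := f.toPositive.exists_norm_apply_le
    exact ⟨c * r, fun n => (hc (a n)).trans (mul_le_mul_of_nonneg_left (hr n) c.2)⟩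

/-- The identity. -/
noncomputable def id (A : Type*) [CStarAlgebra A] [PartialOrder A] [StarOrderedRing A] : SigmaCPU A A where
  toLinearMap := LinearMap.id
  map_cstarMatrix_nonneg' _ _ hM := hM
  map_one' := rfl
  sigmaNormal' _ _ _ hs := hs

/-- Composition. -/
noncomputable def comp (g : SigmaCPU B C) (f : SigmaCPU A B) : SigmaCPU A C where
  toLinearMap := g.toLinearMap ∘ₗ f.toLinearMap
  map_cstarMatrix_nonneg' k M hM :=
    g.map_cstarMatrix_nonneg' k _ (f.map_cstarMatrix_nonneg' k M hM)
  map_one' := (congrArg g f.map_one').trans g.map_one'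
  sigmaNormal' _ _ ha hs := g.sigmaNormal' _ _ (f.isBddMonoSeq ha) (f.sigmaNormal' _ _ ha hs)

end SigmaCPU

/-! ### The category of commutative purely `σ`-representable `σC⋆`-algebras -/

/-- Commutative purely `σ`-representable `σC⋆`-algebras. The order is the usual one, being
determined by `StarOrderedRing`. -/
structure CPureRep : Type (u + 1) where
  /-- The underlying type. -/
  carrier : Type u
  [commCStarAlgebra : CommCStarAlgebra carrier]
  [partialOrder : PartialOrder carrier]
  [starOrderedRing : StarOrderedRing carrier]
  isSigmaComplete : IsSigmaComplete carrier
  isPurelySigmaRepresentable : IsPurelySigmaRepresentable carrier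

attribute [instance] CPureRep.commCStarAlgebra CPureRep.partialOrder CPureRep.starOrderedRing

namespace CPureRep

instance : CoeSort CPureRep.{u} (Type u) := ⟨CPureRep.carrier⟩

noncomputable instance : Category CPureRep.{u} where
  Hom A B := SigmaCPU A B
  id A := SigmaCPU.id A
  comp f g := g.comp f

noncomputable instance : ConcreteCategory CPureRep.{u} (fun A B => SigmaCPU A B) where
  hom f := f
  ofHom f := f

end CPureRep

/-! ### The algebra of bounded measurable functions -/

/-- The bounded measurable functions, among all bounded functions with the supremum norm. -/
def linftySubalgebra (X : Type u) [MeasurableSpace X] : StarSubalgebra ℂ (lp (fun _ : X => ℂ) ∞) where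
  carrier := {f | Measurable fun x => (f x : ℂ)}
  mul_mem' {f g} hf hg := by
    simp only [Set.mem_ofPred_eq, lp.infty_coeFn_mul] at *
    exact hf.mul hg
  add_mem' {f g} hf hg := by
    simp only [Set.mem_ofPred_eq, lp.coeFn_add] at *
    exact hf.add hg
  algebraMap_mem' c := (measurable_const : Measurable fun _ : X => c)
  star_mem' {f} hf := by
    simp only [Set.mem_ofPred_eq, lp.coeFn_star] at *
    exact Complex.continuous_conj.measurable.comp hf

instance linftySubalgebra_isClosed (X : Type u) [MeasurableSpace X] :
    IsClosed (linftySubalgebra X : Set (lp (fun _ : X => ℂ) ∞)) := by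
  refine IsSeqClosed.isClosed fun a f ha hf => ?_
  refine measurable_of_tendsto_metrizable (f := fun n x => (a n x : ℂ)) ha ?_
  rw [tendsto_pi_nhds]
  intro x
  rw [tendsto_iff_norm_sub_tendsto_zero] at hf ⊢
  refine squeeze_zero (fun _ => norm_nonneg _) (fun n => ?_) hf
  exact lp.norm_apply_le_norm (by simp) (a n - f) x

/-- The algebra `𝓛^∞(X)` of bounded measurable functions `X → ℂ`. -/
def LInfty (X : Type u) [MeasurableSpace X] : Type u := linftySubalgebra X

namespace LInfty

variable {X Y Z : Type u} [MeasurableSpace X] [MeasurableSpace Y] [MeasurableSpace Z]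

noncomputable instance : CommCStarAlgebra (LInfty X) :=
  inferInstanceAs (CommCStarAlgebra (linftySubalgebra X))

instance : FunLike (LInfty X) X ℂ where
  coe f := (f : linftySubalgebra X).1
  coe_injective _ _ h := Subtype.ext (Subtype.ext h)

lemma measurable (f : LInfty X) : Measurable f :=
  Subtype.property (p := (· ∈ linftySubalgebra X)) f

lemma norm_apply_le (f : LInfty X) (x : X) : ‖f x‖ ≤ ‖f‖ := 
  lp.norm_apply_le_norm (by simp) (f : linftySubalgebra X).1 x

/-- A bounded measurable function as an element of `LInfty X`. -/
def mk (f : X → ℂ) (hf : Measurable f) (r : ℝ) (hr : ∀ x, ‖f x‖ ≤ r) : LInfty X :=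
  ⟨⟨f, memℓp_infty ⟨r, by rintro _ ⟨x, rfl⟩; exact hr x⟩⟩, hf⟩

@[simp] lemma mk_apply (f : X → ℂ) (hf : Measurable f) (r : ℝ) (hr : ∀ x, ‖f x‖ ≤ r) (x : X) :
    mk f hf r hr x = f x := rfl

@[ext] lemma ext {f g : LInfty X} (h : ∀ x, f x = g x) : f = g :=
  Subtype.ext (Subtype.ext (funext h))

@[simp] lemma add_apply (f g : LInfty X) (x : X) : (f + g) x = f x + g x := rfl
@[simp] lemma sub_apply (f g : LInfty X) (x : X) : (f - g) x = f x - g x := rfl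
@[simp] lemma mul_apply (f g : LInfty X) (x : X) : (f * g) x = f x * g x := rfl
@[simp] lemma smul_apply (c : ℂ) (f : LInfty X) (x : X) : (c • f) x = c * f x := rfl
@[simp] lemma star_apply (f : LInfty X) (x : X) : (star f) x = star (f x) := rfl
@[simp] lemma one_apply (x : X) : (1 : LInfty X) x = 1 := rfl
@[simp] lemma zero_apply (x : X) : (0 : LInfty X) x = 0 := rfl

/-- The pointwise order. -/
instance : PartialOrder (LInfty X) where
  le f g := ∀ x, f x ≤ g x
  le_refl f x := le_rfl
  le_trans f g h h₁ h₂ x := (h₁ x).trans (h₂ x)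
  le_antisymm f g h₁ h₂ := ext fun x => le_antisymm (h₁ x) (h₂ x)

lemma le_def {f g : LInfty X} : f ≤ g ↔ ∀ x, f x ≤ g x := Iff.rfl

instance : StarOrderedRing (LInfty X) :=
  .of_nonneg_iff' (fun {f g} h k x => by simpa using h x) fun f => by
    constructor
    · intro h
      refine ⟨mk (fun x => (Real.sqrt (f x).re : ℂ)) ?_ (Real.sqrt ‖f‖) ?_, ?_⟩
      · exact Complex.measurable_ofReal.comp (Real.continuous_sqrt.measurable.comp
          (Complex.measurable_re.comp f.measurable))
      · intro x
        rw [Complex.norm_real, Real.norm_of_nonneg (Real.sqrt_nonneg _)]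
        exact Real.sqrt_le_sqrt ((Complex.re_le_norm _).trans (f.norm_apply_le x))
      · ext x
        obtain ⟨h1, h2⟩ := Complex.le_def.1 (h x)
        simp only [zero_apply, Complex.zero_re, Complex.zero_im] at h1 h2
        simp only [mul_apply, star_apply, mk_apply, RCLike.star_def, Complex.conj_ofReal]
        rw [← Complex.ofReal_mul, Real.mul_self_sqrt h1]
        exact Complex.ext rfl (by simp [← h2])
    · rintro ⟨s, rfl⟩ x
      simpa using star_mul_self_nonneg (s x)

lemma bddMonoSeq_apply {a : ℕ → LInfty X} (ha : IsBddMonoSeq a) (x : X) :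
    ∃ l : ℝ, Filter.Tendsto (fun n => a n x) Filter.atTop (nhds (l : ℂ)) := by
  obtain ⟨r, hr⟩ := ha.bounded
  have hre : ∀ n, ((a n x).re : ℂ) = a n x := fun n =>
    Complex.conj_eq_iff_re.1 (congrArg (fun f : LInfty X => f x) (ha.isSelfAdjoint n))
  have hm : Monotone fun n => (a n x).re := fun m n h => (Complex.le_def.1 (ha.monotone h x)).1
  have hb : BddAbove (Set.range fun n => (a n x).re) := by
    refine ⟨r, ?_⟩
    rintro _ ⟨n, rfl⟩
    exact (Complex.re_le_norm _).trans (((a n).norm_apply_le x).trans (hr n))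
  refine ⟨_, ((Complex.continuous_ofReal.tendsto _).comp (tendsto_atTop_ciSup hm hb)).congr hre⟩

lemma exists_pointwise_limit {a : ℕ → LInfty X} (ha : IsBddMonoSeq a) :
    ∃ s : LInfty X, ∀ x, Filter.Tendsto (fun n => a n x) Filter.atTop (nhds (s x)) := by
  obtain ⟨r, hr⟩ := ha.bounded
  choose l hl using bddMonoSeq_apply ha
  refine ⟨mk (fun x => (l x : ℂ)) ?_ r fun x => ?_, hl⟩
  · exact measurable_of_tendsto_metrizable (fun n => (a n).measurable) (tendsto_pi_nhds.2 hl)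
  · exact le_of_tendsto (hl x).norm
      (Filter.Eventually.of_forall fun n => ((a n).norm_apply_le x).trans (hr n))

lemma isLUB_of_tendsto {a : ℕ → LInfty X} (ha : Monotone a) {s : LInfty X}
    (hs : ∀ x, Filter.Tendsto (fun n => a n x) Filter.atTop (nhds (s x))) :
    IsLUB (Set.range a) s := by
  have h x := isLUB_of_tendsto_atTop (fun m n h => ha h x : Monotone fun n => a n x) (hs x)
  refine ⟨?_, fun u hu x => (h x).2 ?_⟩
  · rintro _ ⟨n, rfl⟩ x
    exact (h x).1 ⟨n, rfl⟩
  · rintro _ ⟨n, rfl⟩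
    exact hu ⟨n, rfl⟩ x

/-- Suprema of bounded monotone sequences in `LInfty X` are pointwise. -/
lemma tendsto_of_isLUB {a : ℕ → LInfty X} (ha : IsBddMonoSeq a) {s : LInfty X}
    (hs : IsLUB (Set.range a) s) (x : X) :
    Filter.Tendsto (fun n => a n x) Filter.atTop (nhds (s x)) := by
  obtain ⟨t, ht⟩ := exists_pointwise_limit ha
  rw [hs.unique (isLUB_of_tendsto ha.monotone ht)]
  exact ht x

lemma isSigmaComplete : IsSigmaComplete (LInfty X) := fun _ ha =>
  (exists_pointwise_limit ha).imp fun _ hs => isLUB_of_tendsto ha.monotone hs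

/-- Evaluation at a point. -/
def eval (x : X) : LInfty X →⋆ₐ[ℂ] ℂ where
  toFun f := f x
  map_one' := rfl
  map_mul' _ _ := rfl
  map_zero' := rfl
  map_add' _ _ := rfl
  commutes' _ := rfl
  map_star' _ := rfl

@[simp] lemma eval_apply (x : X) (f : LInfty X) : eval x f = f x := rfl

lemma eval_sigmaNormal (x : X) : SigmaNormal (eval x) := fun _ _ ha hs =>
  isLUB_of_tendsto_atTop (fun _ _ h => ha.monotone h x) (tendsto_of_isLUB ha hs x)

lemma eval_mem_states (x : X) : (eval x).toLinearMap ∈ states (LInfty X) :=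
  ⟨fun _ h => h x, rfl⟩

/-- If a state vanishes on `h ^ 2` for a self-adjoint `h`, it vanishes on `h`. -/
lemma state_apply_eq_zero {φ : LInfty X →ₗ[ℂ] ℂ} (hφ : φ ∈ states (LInfty X)) {h : LInfty X}
    (hs : star h = h) (h2 : φ (h * h) = 0) : φ h = 0 := by
  have key : ∀ t : ℝ, 0 ≤ 1 + 2 * (t : ℂ) * φ h := by
    intro t
    have h0 : (0 : LInfty X) ≤ star (1 + (t : ℂ) • h) * (1 + (t : ℂ) • h) := star_mul_self_nonneg _
    have h1 : star (1 + (t : ℂ) • h) * (1 + (t : ℂ) • h)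
        = 1 + (2 * (t : ℂ)) • h + ((t : ℂ) * t) • (h * h) := by
      rw [star_add, star_smul, hs, star_one, RCLike.star_def, Complex.conj_ofReal]
      ext x
      simp only [add_apply, mul_apply, smul_apply, one_apply]
      ring
    have h3 := hφ.1 _ h0
    rw [h1, map_add, map_add, map_smul, map_smul, h2, hφ.2] at h3
    simpa using h3
  have him : (φ h).im = 0 := by
    have := (Complex.le_def.1 (key 1)).2
    simpa using this
  have hre : (φ h).re = 0 := by
    by_contra hne
    have := (Complex.le_def.1 (key (-(φ h).re⁻¹))).1
    simp [him] at this
    rw [mul_assoc, inv_mul_cancel₀ hne] at this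
    norm_num at this
  exact Complex.ext hre him

lemma state_eq_eval {φ : LInfty X →ₗ[ℂ] ℂ} (hφ : φ ∈ states (LInfty X)) (x : X)
    (h : ∀ f : LInfty X, 0 ≤ f → f x = 0 → φ f = 0) : φ = (eval x).toLinearMap := by
  have hsa : ∀ f : LInfty X, star f = f → f x = 0 → φ f = 0 := fun f hf hx =>
    state_apply_eq_zero hφ hf <| h _ (by
      have := star_mul_self_nonneg f
      rwa [hf] at this) (by simp [hx])
  have hz : ∀ f : LInfty X, f x = 0 → φ f = 0 := by
    intro f hx
    have h1 := hsa (f + star f) (by simp [add_comm]) (by simp [hx])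
    have h2 := hsa (Complex.I • (f - star f)) (by
      ext y
      simp only [star_apply, smul_apply, sub_apply, star_mul', star_sub,
        RCLike.star_def, Complex.conj_I, Complex.conj_conj]
      ring) (by simp [hx])
    rw [map_add] at h1
    rw [map_smul, map_sub, smul_eq_mul, mul_eq_zero, or_iff_right Complex.I_ne_zero] at h2
    linear_combination (h1 + h2) / 2
  ext f
  have h1 := hz (f - f x • 1) (by simp)
  rw [map_sub, map_smul, hφ.2, sub_eq_zero] at h1
  simpa using h1

lemma eval_isPureSigmaState (x : X) : IsPureSigmaState (eval x).toLinearMap := by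
  refine ⟨?_, eval_sigmaNormal x⟩
  rw [mem_extremePoints]
  refine ⟨eval_mem_states x, fun φ hφ ψ hψ hseg => ?_⟩
  obtain ⟨a, b, ha, hb, -, hab⟩ := hseg
  have hz : ∀ f : LInfty X, 0 ≤ f → f x = 0 → φ f = 0 ∧ ψ f = 0 := by
    intro f hf hx
    have h1 : (a : ℂ) * φ f + (b : ℂ) * ψ f = 0 := by
      have := congrArg (fun l : LInfty X →ₗ[ℂ] ℂ => l f) hab
      simpa [hx] using this
    have ha' : (0 : ℂ) < a := by exact_mod_cast ha
    have hb' : (0 : ℂ) < b := by exact_mod_cast hb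
    have h2 := (add_eq_zero_iff_of_nonneg (mul_nonneg ha'.le (hφ.1 f hf))
      (mul_nonneg hb'.le (hψ.1 f hf))).1 h1
    exact ⟨(mul_eq_zero.1 h2.1).resolve_left ha'.ne', (mul_eq_zero.1 h2.2).resolve_left hb'.ne'⟩
  exact ⟨state_eq_eval hφ x fun f hf hx => (hz f hf hx).1,
    state_eq_eval hψ x fun f hf hx => (hz f hf hx).2⟩

lemma isPurelySigmaRepresentable : IsPurelySigmaRepresentable (LInfty X) := fun _ _ h =>
  ext fun x => h _ (eval_isPureSigmaState x)

end LInfty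

/-- The object `𝓛^∞(X)`. -/
noncomputable def linftyObj (X : Type u) [MeasurableSpace X] : CPureRep.{u} where
  carrier := LInfty X
  isSigmaComplete := LInfty.isSigmaComplete
  isPurelySigmaRepresentable := LInfty.isPurelySigmaRepresentable

/-! ### Markov kernels act on bounded measurable functions -/

section Positivity

/-- Positivity can be tested along a jointly injective family of star homomorphisms. -/
lemma nonneg_of_jointly_injective {R S ι : Type*} [NonUnitalCStarAlgebra R] [PartialOrder R]
    [StarOrderedRing R] [NonUnitalCStarAlgebra S] [PartialOrder S] [StarOrderedRing S]
    (e : ι → R →⋆ₙₐ[ℂ] S) (he : ∀ M, (∀ x, e x M = 0) → M = 0) {M : R}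
    (h : ∀ x, 0 ≤ e x M) : 0 ≤ M := by
  have hsa : IsSelfAdjoint M := by
    rw [IsSelfAdjoint, ← sub_eq_zero]
    refine he _ fun x => ?_
    rw [map_sub, map_star, (IsSelfAdjoint.of_nonneg (h x)).star_eq, sub_self]
  have hd := CFC.posPart_sub_negPart M hsa
  have hnn : 0 ≤ M⁻ := CFC.negPart_nonneg M
  have hz : M⁻ = 0 := by
    refine he _ fun x => ?_
    set p := e x M⁻ with hp
    have hp0 : 0 ≤ p := map_nonneg (e x) hnn
    have h1 : 0 ≤ p * e x M * p :=
      IsSelfAdjoint.conjugate_nonneg (h x) (IsSelfAdjoint.of_nonneg hp0)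
    have h2 : p * e x M * p = -(p * p * p) := by
      rw [hp, ← map_mul, ← map_mul, ← map_mul, ← map_mul, ← map_neg]
      congr 1
      conv_lhs => enter [1, 2]; rw [← hd]
      rw [mul_sub, CFC.negPart_mul_posPart, zero_sub, neg_mul]
    have h3 : 0 ≤ p * p * p := IsSelfAdjoint.conjugate_nonneg hp0 (IsSelfAdjoint.of_nonneg hp0)
    rw [h2] at h1
    have h4 : p * p * p = 0 := le_antisymm (neg_nonneg.1 h1) h3
    have hps : star p = p := (IsSelfAdjoint.of_nonneg hp0).star_eq
    have h5 : p * p = 0 := by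
      rw [← CStarRing.star_mul_self_eq_zero_iff, star_mul, hps, ← mul_assoc, h4, zero_mul]
    rwa [← CStarRing.star_mul_self_eq_zero_iff, hps]
  rw [← hd, hz, sub_zero]
  exact CFC.posPart_nonneg M

lemma exists_star_mul_self {R : Type*} [NonUnitalCStarAlgebra R] [PartialOrder R]
    [StarOrderedRing R] {a : R} (h : 0 ≤ a) : ∃ s, a = star s * s :=
  CStarAlgebra.nonneg_iff_eq_star_mul_self.1 h

open Matrix

/-- A positive semidefinite matrix is positive in the C⋆-algebra of matrices. -/
lemma nonneg_of_posSemidef {k : ℕ} {N : CStarMatrix (Fin k) (Fin k) ℂ}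
    (h : (CStarMatrix.ofMatrix.symm N).PosSemidef) : 0 ≤ N := by
  open scoped MatrixOrder in
  obtain ⟨S, hS⟩ := (CStarAlgebra.nonneg_iff_eq_star_mul_self).1 h.nonneg
  have : N = star (CStarMatrix.ofMatrix S) * CStarMatrix.ofMatrix S := hS
  rw [this]
  exact star_mul_self_nonneg _

lemma posSemidef_of_nonneg {k : ℕ} {N : CStarMatrix (Fin k) (Fin k) ℂ} (h : 0 ≤ N) :
    (CStarMatrix.ofMatrix.symm N).PosSemidef := by
  obtain ⟨S, hS⟩ := exists_star_mul_self h
  have : CStarMatrix.ofMatrix.symm N =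
      (CStarMatrix.ofMatrix.symm S)ᴴ * CStarMatrix.ofMatrix.symm S := hS
  rw [this]
  exact posSemidef_conjTranspose_mul_self _

end Positivity

namespace LInfty

variable {X Y Z : Type u} [MeasurableSpace X] [MeasurableSpace Y] [MeasurableSpace Z]

/-- Entrywise evaluation of a matrix. -/
noncomputable def evalMatrix (k : ℕ) (x : X) :
    CStarMatrix (Fin k) (Fin k) (LInfty X) →⋆ₙₐ[ℂ] CStarMatrix (Fin k) (Fin k) ℂ :=
  CStarMatrix.mapₙₐ ((eval x : LInfty X →⋆ₐ[ℂ] ℂ) : LInfty X →⋆ₙₐ[ℂ] ℂ)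

/-- A matrix over `LInfty X` is positive if it is so at every point. -/
lemma matrix_nonneg {k : ℕ} {M : CStarMatrix (Fin k) (Fin k) (LInfty X)}
    (h : ∀ x, 0 ≤ evalMatrix k x M) : 0 ≤ M :=
  nonneg_of_jointly_injective (evalMatrix k) (fun _ hN => by
    ext i j x
    exact congrFun (congrFun (hN x) i) j) h

variable (κ : Kernel X Y) [IsMarkovKernel κ]

lemma integrable (μ : Measure Y) [IsProbabilityMeasure μ] (f : LInfty Y) :
    Integrable (fun y => f y) μ :=
  Integrable.of_bound f.measurable.aestronglyMeasurable ‖f‖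
    (Filter.Eventually.of_forall f.norm_apply_le)

/-- Integration against a Markov kernel, `f ↦ (x ↦ ∫ f(y) κ(dy | x))`. -/
noncomputable def koopmanLinear : LInfty Y →ₗ[ℂ] LInfty X where
  toFun f := mk (fun x => ∫ y, f y ∂κ x)
    (f.measurable.stronglyMeasurable.integral_kernel).measurable ‖f‖ (fun x => by
      have := norm_integral_le_of_norm_le_const (μ := κ x) (f := fun y => f y)
        (Filter.Eventually.of_forall f.norm_apply_le)
      simpa using this)
  map_add' f g := ext fun x => integral_add (integrable (κ x) f) (integrable (κ x) g)
  map_smul' c f := ext fun x => integral_const_mul c fun y => f y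

@[simp] lemma koopmanLinear_apply (f : LInfty Y) (x : X) :
    koopmanLinear κ f x = ∫ y, f y ∂κ x := rfl

lemma koopmanLinear_mono : Monotone (koopmanLinear κ) := fun f g h x => by
  rw [← sub_nonneg, koopmanLinear_apply, koopmanLinear_apply,
    ← integral_sub (integrable (κ x) g) (integrable (κ x) f)]
  exact integral_nonneg fun y => sub_nonneg.2 (h y)

lemma koopmanLinear_sigmaNormal : SigmaNormal (koopmanLinear κ) := fun a s ha hs => by
  refine isLUB_of_tendsto (fun m n h => koopmanLinear_mono κ (ha.monotone h)) fun x => ?_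
  obtain ⟨r, hr⟩ := ha.bounded
  exact tendsto_integral_of_dominated_convergence (fun _ => r)
    (fun n => (a n).measurable.aestronglyMeasurable) (integrable_const r)
    (fun n => Filter.Eventually.of_forall fun y => ((a n).norm_apply_le y).trans (hr n))
    (Filter.Eventually.of_forall fun y => tendsto_of_isLUB ha hs y)

open Matrix in
lemma koopmanLinear_cp (k : ℕ) (M : CStarMatrix (Fin k) (Fin k) (LInfty Y)) (hM : 0 ≤ M) :
    0 ≤ M.map (koopmanLinear κ) := by
  refine matrix_nonneg fun x => nonneg_of_posSemidef ?_
  have hpos : ∀ y, (CStarMatrix.ofMatrix.symm (evalMatrix k y M)).PosSemidef := fun y =>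
    posSemidef_of_nonneg (map_nonneg (evalMatrix k y) hM)
  rw [posSemidef_iff_dotProduct_mulVec]
  constructor
  · ext i j
    change star (∫ y, M j i y ∂κ x) = ∫ y, M i j y ∂κ x
    rw [RCLike.star_def, ← integral_conj]
    exact integral_congr_ae (Filter.Eventually.of_forall fun y =>
      congrFun (congrFun (hpos y).1 i) j)
  · intro v
    have : star v ⬝ᵥ (CStarMatrix.ofMatrix.symm (evalMatrix k x (M.map (koopmanLinear κ)))) *ᵥ v
        = ∫ y, star v ⬝ᵥ (CStarMatrix.ofMatrix.symm (evalMatrix k y M)) *ᵥ v ∂κ x := by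
      simp only [dotProduct, mulVec]
      rw [integral_finsetSum]
      · refine Finset.sum_congr rfl fun i _ => ?_
        rw [integral_const_mul, integral_finsetSum]
        · congr 1
          refine Finset.sum_congr rfl fun j _ => ?_
          rw [integral_mul_const]
          rfl
        · intro j _
          exact (integrable (κ x) (M i j)).mul_const _
      · intro i _
        refine Integrable.const_mul (integrable_finsetSum _ fun j _ => ?_) _
        exact (integrable (κ x) (M i j)).mul_const _
    rw [this]
    exact integral_nonneg fun y => (hpos y).dotProduct_mulVec_nonneg v

/-- The `σ`-cpu map `𝓛^∞(κ) : 𝓛^∞(Y) → 𝓛^∞(X)`. -/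
noncomputable def koopman : SigmaCPU (LInfty Y) (LInfty X) where
  toLinearMap := koopmanLinear κ
  map_cstarMatrix_nonneg' := koopmanLinear_cp κ
  map_one' := ext fun x => by
    change ∫ _, (1 : ℂ) ∂κ x = 1
    simp
  sigmaNormal' := koopmanLinear_sigmaNormal κ

lemma koopman_apply (f : LInfty Y) (x : X) : koopman κ f x = ∫ y, f y ∂κ x := rfl

end LInfty

/-- The functor `𝓛^∞` from `Stoch` to the opposite of the category of commutative purely
`σ`-representable `σC⋆`-algebras, acting on kernels by integration. -/
noncomputable def LInftyFunctor : Stoch.{u} ⥤ CPureRep.{u}ᵒᵖ where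
  obj X := Opposite.op (linftyObj X.obj)
  map κ := Quiver.Hom.op (X := linftyObj _) (Y := linftyObj _) (LInfty.koopman κ.hom.hom)
  map_id X := by
    apply Quiver.Hom.unop_inj
    refine SigmaCPU.ext (A := LInfty X.obj) (B := LInfty X.obj) fun f => LInfty.ext fun x => ?_
    change ∫ y, f y ∂(Kernel.id x) = f x
    rw [Kernel.id_apply, integral_dirac' _ _ f.measurable.stronglyMeasurable]
  map_comp {X Y Z} κ η := by
    apply Quiver.Hom.unop_inj
    refine SigmaCPU.ext (A := LInfty Z.obj) (B := LInfty X.obj) fun f => LInfty.ext fun x => ?_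
    exact Kernel.integral_comp (κ := κ.hom.hom) (η := η.hom.hom) (LInfty.integrable _ f)

/-- The value at a point of an element of the algebra `𝓛^∞(X)`. -/
def linftyEval {X : Stoch.{u}} (f : (LInftyFunctor.obj X).unop) (x : X.obj) : ℂ :=
  (show LInfty X.obj from f) x

/-! ### The Gelfand `σ`-spectrum -/

/-- The Gelfand `σ`-spectrum: the `σ`-normal unital star homomorphisms `A → ℂ`. -/
def SigmaSpec (A : Type u) [CommCStarAlgebra A] [PartialOrder A] : Type u :=
  {φ : A →⋆ₐ[ℂ] ℂ // SigmaNormal φ}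

namespace SigmaSpec

variable {A : Type u} [CommCStarAlgebra A] [PartialOrder A]

instance : FunLike (SigmaSpec A) A ℂ where
  coe φ := φ.1
  coe_injective _ _ h := Subtype.ext (DFunLike.coe_injective h)

/-- The smallest `σ`-algebra making all evaluation maps `φ ↦ φ a` measurable. -/
noncomputable instance : MeasurableSpace (SigmaSpec A) :=
  ⨆ a : A, MeasurableSpace.comap (fun φ : SigmaSpec A => φ a) inferInstance

end SigmaSpec

/-- The Gelfand `σ`-spectrum as an object of `Stoch`. -/
noncomputable def specObj (A : CPureRep.{u}) : Stoch.{u} := ⟨SFinKer.of (SigmaSpec A)⟩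

/-- The point of the `σ`-spectrum of `𝓛^∞(X)` given by evaluation at a point of `X`. -/
noncomputable def evalPoint {X : Stoch.{u}} (x : X.obj) : SigmaSpec (LInftyFunctor.obj X).unop :=
  ⟨LInfty.eval (X := X.obj) x, LInfty.eval_sigmaNormal (X := X.obj) x⟩

/-- A functorial action of the Gelfand `σ`-spectrum on `σ`-cpu maps: for `f : A → B`, the Markov
kernel from the spectrum of `B` to that of `A` sends `ψ` to the probability measure that represents
the `σ`-state `ψ ∘ f` on `A`. -/
structure SigmaSpecAction where
  /-- The Markov kernel associated to a `σ`-cpu map. -/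
  map : ∀ {A B : CPureRep.{u}}, (A ⟶ B) → (specObj B ⟶ specObj A)
  map_id : ∀ A : CPureRep.{u}, map (𝟙 A) = 𝟙 (specObj A)
  map_comp : ∀ {A B C : CPureRep.{u}} (f : A ⟶ B) (g : B ⟶ C), map (f ≫ g) = map g ≫ map f
  integral_map : ∀ {A B : CPureRep.{u}} (f : A ⟶ B) (ψ : SigmaSpec B) (a : A),
    ∫ φ : SigmaSpec A, φ a ∂((map f).hom.hom ψ) = ψ (f a)

/-- The functor given on objects by the Gelfand `σ`-spectrum. -/
noncomputable def SigmaSpecAction.functor (S : SigmaSpecAction.{u}) : CPureRep.{u}ᵒᵖ ⥤ Stoch.{u} where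
  obj A := specObj A.unop
  map f := S.map f.unop
  map_id A := S.map_id A.unop
  map_comp f g := S.map_comp g.unop f.unop

/-! ### The regular tensor product -/

/-- `j : A → B` is a `σ`-completion: `B` is a `σC⋆`-algebra, `j` is an injective `σ`-normal star
homomorphism, and `B` is the smallest `σ`-closed star subspace that contains the range of `j`. -/
structure IsSigmaCompletion {A B : Type*} [CStarAlgebra A] [PartialOrder A]
    [CStarAlgebra B] [PartialOrder B] (j : A →⋆ₐ[ℂ] B) : Prop where
  isSigmaComplete : IsSigmaComplete B
  injective : Function.Injective j
  sigmaNormal : SigmaNormal j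
  generates : ∀ V : Submodule ℂ B, (∀ b ∈ V, star b ∈ V) →
    (∀ (b : ℕ → B) (s : B), IsBddMonoSeq b → (∀ n, b n ∈ V) → IsLUB (Set.range b) s → s ∈ V) →
    (∀ a, j a ∈ V) → V = ⊤

/-- `j : A → B` is the regular `σ`-completion: every self-adjoint `b` is the supremum of the
elements `j a ≤ b`. -/
structure IsRegularSigmaCompletion {A B : Type*} [CStarAlgebra A] [PartialOrder A]
    [CStarAlgebra B] [PartialOrder B] (j : A →⋆ₐ[ℂ] B) : Prop extends IsSigmaCompletion j where
  isLUB : ∀ b : B, IsSelfAdjoint b → IsLUB {c | c ≤ b ∧ ∃ a, j a = c} b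

/-- `T` is the C⋆-tensor product of the commutative C⋆-algebras `A` and `B`, that is, their
coproduct in the category of commutative unital C⋆-algebras and unital star homomorphisms. -/
def IsCStarTensorProduct {A B T : Type u} [CommCStarAlgebra A] [CommCStarAlgebra B]
    [CommCStarAlgebra T] (i₁ : A →⋆ₐ[ℂ] T) (i₂ : B →⋆ₐ[ℂ] T) : Prop :=
  ∀ (D : Type u) [CommCStarAlgebra D] (f : A →⋆ₐ[ℂ] D) (g : B →⋆ₐ[ℂ] D),
    ∃! h : T →⋆ₐ[ℂ] D, h.comp i₁ = f ∧ h.comp i₂ = g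

/-- `R`, with the homomorphisms `a ↦ a ⊗ 1` and `b ↦ 1 ⊗ b`, is the regular tensor product of `A`
and `B`: the regular `σ`-completion of their C⋆-tensor product. -/
def IsRegularTensorProduct {A B R : Type u} [CommCStarAlgebra A] [CommCStarAlgebra B]
    [CommCStarAlgebra R] [PartialOrder R] (ι₁ : A →⋆ₐ[ℂ] R) (ι₂ : B →⋆ₐ[ℂ] R) : Prop :=
  ∃ (T : Type u) (_ : CommCStarAlgebra T) (_ : PartialOrder T) (_ : StarOrderedRing T)
    (i₁ : A →⋆ₐ[ℂ] T) (i₂ : B →⋆ₐ[ℂ] T) (j : T →⋆ₐ[ℂ] R),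
    IsCStarTensorProduct i₁ i₂ ∧ IsRegularSigmaCompletion j ∧ j.comp i₁ = ι₁ ∧ j.comp i₂ = ι₂

/-- Homomorphisms `a ↦ a ⊗ 1` and `b ↦ 1 ⊗ b` into the objects `A ⊗ B` of a monoidal structure. -/
structure TensorInclusions [MonoidalCategory CPureRep.{u}] where
  /-- `a ↦ a ⊗ 1` -/
  inl : ∀ A B : CPureRep.{u}, A →⋆ₐ[ℂ] (A ⊗ B : CPureRep.{u})
  /-- `b ↦ 1 ⊗ b` -/
  inr : ∀ A B : CPureRep.{u}, B →⋆ₐ[ℂ] (A ⊗ B : CPureRep.{u})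

/-- The elementary tensor `a ⊗ b`. -/
def TensorInclusions.tmul [MonoidalCategory CPureRep.{u}] (T : TensorInclusions.{u})
    {A B : CPureRep.{u}} (a : A) (b : B) : (A ⊗ B : CPureRep.{u}) :=
  T.inl A B a * T.inr A B b

/-- The symmetric monoidal structure is the one of the regular tensor product: the objects `A ⊗ B`
are regular tensor products, the unit is `ℂ`, and tensor products of morphisms and the structure
isomorphisms are the canonical ones on elementary tensors. -/
structure IsRegularMonoidal [MonoidalCategory CPureRep.{u}] [SymmetricCategory CPureRep.{u}]
    (T : TensorInclusions.{u}) : Prop where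
  isRegularTensorProduct : ∀ A B, IsRegularTensorProduct (T.inl A B) (T.inr A B)
  unit : Function.Bijective (algebraMap ℂ (𝟙_ CPureRep.{u}))
  tensorHom : ∀ {A A' B B' : CPureRep.{u}} (f : A ⟶ A') (g : B ⟶ B') (a : A) (b : B),
    (f ⊗ₘ g) (T.tmul a b) = T.tmul (f a) (g b)
  associator : ∀ {A B C : CPureRep.{u}} (a : A) (b : B) (c : C),
    (α_ A B C).hom (T.tmul (T.tmul a b) c) = T.tmul a (T.tmul b c)
  leftUnitor : ∀ {A : CPureRep.{u}} (z : ℂ) (a : A),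
    (λ_ A).hom (T.tmul (algebraMap ℂ (𝟙_ CPureRep.{u}) z) a) = z • a
  rightUnitor : ∀ {A : CPureRep.{u}} (z : ℂ) (a : A),
    (ρ_ A).hom (T.tmul a (algebraMap ℂ (𝟙_ CPureRep.{u}) z)) = z • a
  braiding : ∀ {A B : CPureRep.{u}} (a : A) (b : B), (β_ A B).hom (T.tmul a b) = T.tmul b a

/-- The Markov category structure on the opposite category has the braiding of the given symmetric
monoidal structure, and its copy and discard morphisms are the multiplications `a ⊗ b ↦ a b` and
the units `ℂ → A` of the algebras. -/
structure IsAlgebraicMarkov [MonoidalCategory CPureRep.{u}] [SymmetricCategory CPureRep.{u}]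
    (T : TensorInclusions.{u}) (K : MarkovCategory CPureRep.{u}ᵒᵖ) : Prop where
  braiding : ∀ A B : CPureRep.{u},
    (K.toBraidedCategory.braiding (Opposite.op A) (Opposite.op B)).hom = (β_ B A).hom.op
  copy : ∀ {A : CPureRep.{u}} (a b : A),
    (K.comonObj (Opposite.op A)).comul.unop (T.tmul a b) = a * b
  discard : ∀ {A : CPureRep.{u}} (z : ℂ),
    (K.comonObj (Opposite.op A)).counit.unop (algebraMap ℂ (𝟙_ CPureRep.{u}) z) = algebraMap ℂ A z

end SigmaCStar

open SigmaCStar Opposite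
open scoped ComonObj

/-! The equivalence rests on two facts.

First, every algebra `A` in the category is the algebra of bounded measurable functions on its
`σ`-spectrum. An extremal state of a commutative C⋆-algebra is multiplicative, so pure `σ`-states
are points of the spectrum. These points therefore separate elements and determine the order
(`CPureRep.eq_zero_of_forall_spec`, `CPureRep.nonneg_iff`). By `σ`-completeness, bounded increasing
pointwise limits of Gelfand transforms are again Gelfand transforms. Continuous functional calculus
then yields the indicator functions of `{φ | φ a ∈ U}` for open `U`, and hence of all measurable
sets. A monotone class argument gives surjectivity (`CPureRep.gelfand_surjective`).

Second, `σ`-normality of a state on `𝓛^∞(X)` is countable additivity, so such a state is integration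
against a unique probability measure (`LInfty.integral_stateMeasure`, `LInfty.measure_ext`).
Composing a `σ`-cpu map with the points of the spectrum of its codomain thus yields a Markov kernel,
and kernels are equal when they act equally on functions. No regularity of `X` is needed. The map `x
↦ ev_x` may fail to be injective or surjective, yet its Dirac kernel is invertible: the inverse
sends a `σ`-normal character to the measure representing it.

For the tensor product, take `𝓛^∞(Spec A × Spec B)`. Around every point, a measurable function on a
product is constant on some measurable rectangle (`exists_rectangle_eq`). Indicators of rectangles
lie in the C⋆-tensor product, so they correct a would-be supremum locally; this proves both
`σ`-normality of the inclusion and regularity of the completion.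

Morphisms `a ⊗ b ↦ f a * g b` come from products of kernels (`CPureRep.lift`). Morphisms out of a
tensor product are determined by elementary tensors, because they respect bounded pointwise limits.
All coherence laws, and the comonoid laws of the Markov structure, thereby become identities between
elementary tensors. The monoidal structure of the spectrum functor is transported along the
equivalence. -/

lemma Complex.tendsto_of_monotone_isLUB {c : ℕ → ℂ} (hc : Monotone c) {s : ℂ}
    (h : IsLUB (Set.range c) s) : Filter.Tendsto c Filter.atTop (nhds s) := by
  -- Comparable complex numbers share their imaginary part, so an upper bound confines the sequence
  -- to a horizontal line.
  have hle : ∀ n, (c n).re ≤ s.re ∧ (c n).im = s.im := fun n => Complex.le_def.1 (h.1 ⟨n, rfl⟩)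
  have hm : Monotone fun n => (c n).re := fun m n h => (Complex.le_def.1 (hc h)).1
  have hb : BddAbove (Set.range fun n => (c n).re) := ⟨s.re, by rintro _ ⟨n, rfl⟩; exact (hle n).1⟩
  have ht : Filter.Tendsto c Filter.atTop
      (nhds (((⨆ n, (c n).re : ℝ) : ℂ) + s.im * Complex.I)) := by
    refine (((Complex.continuous_ofReal.tendsto _).comp (tendsto_atTop_ciSup hm hb)).add_const
      (s.im * Complex.I)).congr fun n => ?_
    rw [← (hle n).2]
    exact Complex.re_add_im _
  rwa [h.unique (isLUB_of_tendsto_atTop hc ht)]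

namespace SigmaCStar

/-! ### Monotone class arguments for bounded measurable functions -/

namespace LInfty

variable {X Y : Type u} [MeasurableSpace X] [MeasurableSpace Y]

/-- The indicator function of a measurable set. -/
noncomputable def ind {E : Set X} (hE : MeasurableSet E) : LInfty X :=
  mk (E.indicator fun _ => 1) (measurable_const.indicator hE) 1 fun x => by
    by_cases h : x ∈ E <;> simp [h]

lemma ind_apply {E : Set X} (hE : MeasurableSet E) (x : X) :
    ind hE x = E.indicator (fun _ => (1 : ℂ)) x := rfl

lemma isSelfAdjoint_iff {f : LInfty X} : IsSelfAdjoint f ↔ ∀ x, ((f x).re : ℂ) = f x := by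
  constructor
  · intro h x
    exact Complex.conj_eq_iff_re.1 (congrArg (fun f : LInfty X => f x) h)
  · intro h
    ext x
    exact Complex.conj_eq_iff_re.2 (h x)

lemma norm_le_of_forall {f : LInfty X} {r : ℝ} (hr : 0 ≤ r) (h : ∀ x, ‖f x‖ ≤ r) : ‖f‖ ≤ r :=
  lp.norm_le_of_forall_le (f := (show linftySubalgebra X from f).1) hr h

/-- A pointwise bounded and increasing sequence of real functions is a bounded monotone sequence. -/
lemma isBddMonoSeq_of_forall {a : ℕ → LInfty X} {r : ℝ} (hr : 0 ≤ r)
    (hre : ∀ n x, ((a n x).re : ℂ) = a n x) (hmono : Monotone a) (hb : ∀ n x, ‖a n x‖ ≤ r) :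
    IsBddMonoSeq a :=
  ⟨fun n => isSelfAdjoint_iff.2 (hre n), hmono, r, fun n => norm_le_of_forall hr (hb n)⟩

/-- A subspace is closed under suprema of bounded monotone sequences. -/
def IsSigmaClosed {A : Type*} [CStarAlgebra A] [PartialOrder A] (V : Submodule ℂ A) : Prop :=
  ∀ (b : ℕ → A) (s : A), IsBddMonoSeq b → (∀ n, b n ∈ V) → IsLUB (Set.range b) s → s ∈ V

/-- Simple functions are combinations of indicators, nonnegative functions are increasing limits of
simple ones, and the nonnegative elements of a C⋆-algebra span it. -/
lemma eq_top_of_ind_mem {V : Submodule ℂ (LInfty X)} (hV : IsSigmaClosed V)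
    (h : ∀ (E : Set X) (hE : MeasurableSet E), ind hE ∈ V) : V = ⊤ := by
  have hsimple : ∀ s : SimpleFunc X ℂ, ∀ f : LInfty X, (∀ x, f x = s x) → f ∈ V := by
    intro s
    induction s using SimpleFunc.induction with
    | const c hs =>
      rename_i E
      intro f hf
      have : f = c • ind hs := by
        ext x
        rw [hf, smul_apply, ind_apply]
        by_cases hx : x ∈ E <;> simp [hx]
      exact this ▸ V.smul_mem c (h _ hs)
    | add _ hs ht =>
      rename_i s t _
      intro f hf
      have hbd : ∀ u : SimpleFunc X ℂ, ∃ r, ∀ x, ‖u x‖ ≤ r := fun u => by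
        obtain ⟨r, hr⟩ := u.exists_forall_norm_le
        exact ⟨r, hr⟩
      obtain ⟨r, hr⟩ := hbd s
      obtain ⟨r', hr'⟩ := hbd t
      have : f = mk s s.measurable r hr + mk t t.measurable r' hr' := by
        ext x
        rw [hf]
        rfl
      exact this ▸ V.add_mem (hs _ fun _ => rfl) (ht _ fun _ => rfl)
  have hnonneg : ∀ f : LInfty X, 0 ≤ f → f ∈ V := by
    intro f hf
    have hre : ∀ x, ((f x).re : ℂ) = f x := fun x =>
      (Complex.eq_re_of_ofReal_le (r := 0) (by simpa using hf x)).symm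
    have h0 : ∀ x, 0 ≤ (f x).re := fun x => (Complex.le_def.1 (hf x)).1
    -- Increasing simple approximations come from `SimpleFunc.eapprox` for extended nonnegative
    -- functions. They stay below `F`, hence finite, and can be carried back to `ℂ`.
    let F : X → ℝ≥0∞ := fun x => ENNReal.ofReal (f x).re
    have hF : Measurable F := (Complex.measurable_re.comp f.measurable).ennreal_ofReal
    have hle : ∀ n x, SimpleFunc.eapprox F n x ≤ F x := fun n x => by
      rw [← SimpleFunc.iSup_eapprox_apply hF x]
      exact le_iSup (fun n => SimpleFunc.eapprox F n x) n
    have hbd : ∀ n x, (SimpleFunc.eapprox F n x).toReal ≤ (f x).re := fun n x =>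
      ENNReal.toReal_le_of_le_ofReal (h0 x) (hle n x)
    have hnorm : ∀ n x, ‖((SimpleFunc.eapprox F n x).toReal : ℂ)‖ ≤ ‖f‖ := fun n x => by
      rw [Complex.norm_real, Real.norm_of_nonneg ENNReal.toReal_nonneg]
      exact (hbd n x).trans ((Complex.re_le_norm _).trans (f.norm_apply_le x))
    let s : ℕ → SimpleFunc X ℂ := fun n =>
      (SimpleFunc.eapprox F n).map fun r => (r.toReal : ℂ)
    let b : ℕ → LInfty X := fun n => mk (s n) (s n).measurable ‖f‖ (hnorm n)
    have hmono : Monotone b := fun m n hmn x => by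
      refine Complex.real_le_real.2 (ENNReal.toReal_mono ?_ (SimpleFunc.monotone_eapprox F hmn x))
      exact ((hle n x).trans_lt ENNReal.ofReal_lt_top).ne
    refine hV b f (isBddMonoSeq_of_forall (norm_nonneg f) (fun n x => ?_) hmono hnorm)
      (fun n => hsimple (s n) _ fun _ => rfl) (isLUB_of_tendsto hmono fun x => ?_)
    · exact congrArg _ (Complex.ofReal_re _)
    · have h1 : Filter.Tendsto (fun n => SimpleFunc.eapprox F n x) Filter.atTop (nhds (F x)) := by
        rw [← SimpleFunc.iSup_eapprox_apply hF x]
        exact tendsto_atTop_iSup fun m n hmn => SimpleFunc.monotone_eapprox F hmn x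
      have h2 := (ENNReal.tendsto_toReal ENNReal.ofReal_ne_top).comp h1
      rw [ENNReal.toReal_ofReal (h0 x)] at h2
      have h3 := (Complex.continuous_ofReal.tendsto _).comp h2
      rw [hre] at h3
      exact h3
  rw [eq_top_iff, ← CStarAlgebra.span_nonneg, Submodule.span_le]
  exact hnonneg

/-- Countable disjoint unions of sets are suprema of finite sums of indicator functions. -/
lemma ind_iUnion {f : ℕ → Set X} (hm : ∀ i, MeasurableSet (f i))
    (hd : _root_.Pairwise (Function.onFun Disjoint f)) :
    IsBddMonoSeq (fun n => ∑ k ∈ Finset.range n, ind (hm k)) ∧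
      IsLUB (Set.range fun n => ∑ k ∈ Finset.range n, ind (hm k))
        (ind (MeasurableSet.iUnion hm)) := by
  -- By disjointness each partial sum is itself an indicator, which gives the bound and the
  -- pointwise limit at once.
  have key : ∀ n x, (∑ k ∈ Finset.range n, ind (hm k)) x =
      (⋃ k ∈ Finset.range n, f k).indicator (fun _ => (1 : ℂ)) x := fun n x => by
    rw [Finset.indicator_biUnion_apply _ _ fun i _ j _ hij => hd hij]
    induction n with
    | zero => rfl
    | succ n ih => rw [Finset.sum_range_succ, add_apply, ih, Finset.sum_range_succ, ind_apply]
  have hmono : Monotone fun n => ∑ k ∈ Finset.range n, ind (hm k) := fun m n hmn x => by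
    rw [key, key]
    refine Set.indicator_le_indicator_of_subset ?_ (fun _ => zero_le_one) x
    exact Set.biUnion_subset_biUnion_left fun k hk =>
      Finset.mem_range.2 ((Finset.mem_range.1 hk).trans_le hmn)
  refine ⟨isBddMonoSeq_of_forall zero_le_one (fun n x => ?_) hmono fun n x => ?_,
    isLUB_of_tendsto hmono fun x => ?_⟩
  · rw [key]
    by_cases hx : x ∈ ⋃ k ∈ Finset.range n, f k
    · rw [Set.indicator_of_mem hx, Complex.one_re, Complex.ofReal_one]
    · rw [Set.indicator_of_notMem hx, Complex.zero_re, Complex.ofReal_zero]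
  · rw [key]
    refine (norm_indicator_le_norm_self _ _).trans ?_
    simp
  · simp_rw [key]
    rw [ind_apply]
    refine tendsto_const_nhds.congr' ?_
    by_cases hx : x ∈ ⋃ k, f k
    · obtain ⟨k, hk⟩ := Set.mem_iUnion.1 hx
      filter_upwards [Filter.eventually_gt_atTop k] with n hn
      rw [Set.indicator_of_mem hx, Set.indicator_of_mem]
      exact Set.mem_biUnion (Finset.mem_range.2 hn) hk
    · refine Filter.Eventually.of_forall fun n => ?_
      simp only
      rw [Set.indicator_of_notMem hx, Set.indicator_of_notMem]
      exact fun h => hx (Set.iUnion₂_subset_iUnion _ _ h)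

/-- A functional form of the monotone class theorem. -/
lemma eq_top_of_isPiSystem {V : Submodule ℂ (LInfty X)} (hV : IsSigmaClosed V) {C : Set (Set X)}
    (hgen : ‹MeasurableSpace X› = MeasurableSpace.generateFrom C) (hpi : IsPiSystem C)
    (hone : 1 ∈ V) (h : ∀ (E : Set X) (hE : MeasurableSet E), E ∈ C → ind hE ∈ V) : V = ⊤ := by
  refine eq_top_of_ind_mem hV fun E hE => ?_
  induction E, hE using MeasurableSpace.induction_on_inter hgen hpi with
  | empty =>
    have : ind (X := X) MeasurableSet.empty = 0 := by ext x; simp [ind_apply]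
    exact this ▸ V.zero_mem
  | basic E hE =>
    exact h E _ hE
  | compl E hE ih =>
    have : ind hE.compl = 1 - ind hE := by
      ext x
      by_cases hx : x ∈ E <;> simp [ind_apply, hx]
    exact this ▸ V.sub_mem hone ih
  | iUnion f hd hm ih =>
    exact hV _ _ (ind_iUnion hm hd).1 (fun n => V.sum_mem fun k _ => ih k) (ind_iUnion hm hd).2

end LInfty

/-! ### Multiplicativity of pure states -/

section PureStates

variable {A : Type*} [CommCStarAlgebra A] [PartialOrder A] [StarOrderedRing A]

/-- Cutting down a state by a positive element. -/
lemma states.cutdown {φ : A →ₗ[ℂ] ℂ} (hφ : φ ∈ states A) {a : A} (ha : 0 ≤ a) {t : ℝ}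
    (ht : 0 < t) (hat : φ a = t) :
    ((t : ℂ)⁻¹ • φ ∘ₗ LinearMap.mulLeft ℂ a) ∈ states A := by
  refine ⟨fun b hb => ?_, ?_⟩
  · have h1 : 0 ≤ φ (a * b) := by
      -- Commutativity turns `star s * s * b` into `star s * b * s`, which is positive.
      obtain ⟨s, rfl⟩ := exists_star_mul_self ha
      refine hφ.1 _ ?_
      rw [mul_right_comm]
      exact star_left_conjugate_nonneg hb s
    have h2 : (0 : ℂ) ≤ (t : ℂ)⁻¹ := by
      rw [← Complex.ofReal_inv]
      exact_mod_cast (inv_pos.2 ht).le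
    exact mul_nonneg h2 h1
  · have : (t : ℂ) ≠ 0 := by exact_mod_cast ht.ne'
    simp [hat, this]

/-- Pure states of commutative C⋆-algebras are multiplicative. -/
lemma states.map_mul_of_mem_extremePoints {φ : A →ₗ[ℂ] ℂ}
    (hφ : φ ∈ Set.extremePoints ℝ (states A)) (a b : A) : φ (a * b) = φ a * φ b := by
  obtain ⟨hs, hex⟩ := mem_extremePoints.1 hφ
  -- Cutting down by `c` and by `1 - c` gives two states whose convex combination with weights `t`
  -- and `1 - t` is `φ`. Extremality makes the first equal to `φ`.
  have key : ∀ c : A, 0 ≤ c → ∀ t : ℝ, 0 < t → t < 1 → φ c = t → c ≤ 1 →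
      φ (c * b) = φ c * φ b := by
    intro c hc t ht ht1 hct hc1
    have h1 : φ (1 - c) = ((1 - t : ℝ) : ℂ) := by
      rw [map_sub, hs.2, hct]
      push_cast
      rfl
    have h := (hex _ (states.cutdown hs hc ht hct) _
      (states.cutdown hs (sub_nonneg.2 hc1) (sub_pos.2 ht1) h1)
      ⟨t, 1 - t, ht, sub_pos.2 ht1, by ring, ?_⟩).1
    · have h2 := congrArg (fun l : A →ₗ[ℂ] ℂ => l b) h
      simp only [LinearMap.smul_apply, LinearMap.comp_apply, LinearMap.mulLeft_apply,
        smul_eq_mul] at h2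
      have h3 : (t : ℂ) ≠ 0 := by exact_mod_cast ht.ne'
      rw [hct, ← h2, mul_inv_cancel_left₀ h3]
    · have h3 : (t : ℂ) ≠ 0 := by exact_mod_cast ht.ne'
      have h4 : ((1 - t : ℝ) : ℂ) ≠ 0 := by exact_mod_cast (sub_pos.2 ht1).ne'
      ext x
      simp only [LinearMap.add_apply, LinearMap.smul_apply, LinearMap.comp_apply,
        LinearMap.mulLeft_apply, Complex.real_smul, smul_eq_mul]
      rw [mul_inv_cancel_left₀ h3, mul_inv_cancel_left₀ h4, ← map_add, ← add_mul, add_sub_cancel,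
        one_mul]
  have key2 : ∀ c : A, 0 ≤ c → φ (c * b) = φ c * φ b := by
    intro c hc
    obtain ⟨r, hr, hcr⟩ : ∃ r : ℝ, 0 < r ∧ c ≤ algebraMap ℝ A r := by
      refine ⟨‖c‖ + 1, by positivity, ?_⟩
      exact (CStarAlgebra.norm_le_iff_le_algebraMap c (by positivity) hc).1 (by linarith)
    obtain ⟨hre, him⟩ := Complex.le_def.1 (hs.1 c hc)
    have hcre : φ c = ((φ c).re : ℂ) := Complex.ext rfl (by simpa using him.symm)
    have hle : (φ c).re ≤ r := by
      have := hs.1 _ (sub_nonneg.2 hcr)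
      rw [map_sub, IsScalarTower.algebraMap_apply ℝ ℂ A, Algebra.algebraMap_eq_smul_one, map_smul,
        hs.2] at this
      simpa using (Complex.le_def.1 this).1
    -- The rescaling satisfies `0 ≤ d ≤ 1` and places `φ d` between `1/4` and `3/4`, so that `key`
    -- applies without boundary cases. The identity for `c` follows by linearity.
    set d : A := (1 / 4 : ℂ) • 1 + (1 / (2 * r) : ℂ) • c with hd
    have hr' : (r : ℂ) ≠ 0 := by exact_mod_cast hr.ne'
    have e1 : (0 : ℂ) ≤ 1 / 4 := by
      have : (0 : ℂ) ≤ ((1 / 4 : ℝ) : ℂ) := Complex.real_le_real.2 (by norm_num)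
      simp at this ⊢
    have e2 : (0 : ℂ) ≤ 1 / (2 * r) := by
      have : (0 : ℝ) ≤ 1 / (2 * r) := by positivity
      exact_mod_cast this
    have hd0 : 0 ≤ d := add_nonneg (smul_nonneg e1 zero_le_one) (smul_nonneg e2 hc)
    have hd1 : d ≤ 1 := by
      have h1 : (1 / (2 * r) : ℂ) • c ≤ (1 / (2 * r) : ℂ) • algebraMap ℝ A r :=
        smul_le_smul_of_nonneg_left hcr e2
      have h2 : (1 / (2 * r) : ℂ) • algebraMap ℝ A r = (1 / 2 : ℂ) • (1 : A) := by
        rw [IsScalarTower.algebraMap_apply ℝ ℂ A, Algebra.algebraMap_eq_smul_one, smul_smul]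
        congr 1
        change 1 / (2 * (r : ℂ)) * r = 1 / 2
        field_simp
      have h3 : d ≤ (1 / 4 : ℂ) • (1 : A) + (1 / 2 : ℂ) • (1 : A) :=
        add_le_add le_rfl (h1.trans_eq h2)
      refine h3.trans ?_
      have h4 : (1 : A) = (1 / 4 : ℂ) • (1 : A) + (1 / 2 : ℂ) • (1 : A) + (1 / 4 : ℂ) • (1 : A) := by
        rw [← add_smul, ← add_smul]
        norm_num
      conv_rhs => rw [h4]
      exact le_add_of_nonneg_right (smul_nonneg e1 zero_le_one)
    have hφd : φ d = ((1 / 4 + 1 / (2 * r) * (φ c).re : ℝ) : ℂ) := by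
      rw [hd, map_add, map_smul, map_smul, hs.2, hcre]
      push_cast
      simp
    have hpos : 0 ≤ 1 / (2 * r) * (φ c).re := mul_nonneg (by positivity) hre
    have hlt : 1 / (2 * r) * (φ c).re ≤ 1 / 2 := by
      rw [div_mul_eq_mul_div, one_mul, div_le_div_iff₀ (by positivity) two_pos]
      linarith
    have h := key d hd0 _ (by linarith) (by linarith) hφd hd1
    rw [hd, add_mul, smul_mul_assoc, smul_mul_assoc, one_mul] at h
    simp only [map_add, map_smul, hs.2, smul_eq_mul, mul_one] at h
    have h5 : (1 / (2 * r) : ℂ) ≠ 0 := by simpa using hr'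
    exact mul_left_cancel₀ h5 (by linear_combination h)
  have : a ∈ Submodule.span ℂ {a : A | 0 ≤ a} := by
    rw [CStarAlgebra.span_nonneg]
    trivial
  induction this using Submodule.span_induction with
  | mem x hx => exact key2 x hx
  | zero => simp
  | add x y _ _ hx hy => rw [add_mul, map_add, map_add, hx, hy, add_mul]
  | smul c x _ hx => rw [smul_mul_assoc, map_smul, map_smul, hx, smul_mul_assoc]

/-- Pure states of commutative C⋆-algebras are characters. -/
noncomputable def IsPureSigmaState.toStarAlgHom {φ : A →ₗ[ℂ] ℂ} (hφ : IsPureSigmaState φ) :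
    A →⋆ₐ[ℂ] ℂ :=
  let ψ : A →ₐ[ℂ] ℂ := AlgHom.ofLinearMap φ (mem_extremePoints.1 hφ.1).1.2
    (states.map_mul_of_mem_extremePoints hφ.1)
  { ψ with map_star' := fun a => (AlgHomClass.instStarHomClass (F := A →ₐ[ℂ] ℂ)).map_star ψ a }

end PureStates

/-! ### Points of the `σ`-spectrum -/

namespace SigmaSpec

variable {A : Type u} [CommCStarAlgebra A] [PartialOrder A]

instance : AlgHomClass (SigmaSpec A) ℂ A ℂ where
  map_mul φ := map_mul φ.1
  map_one φ := map_one φ.1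
  map_add φ := map_add φ.1
  map_zero φ := map_zero φ.1
  commutes φ := AlgHomClass.commutes φ.1

instance : StarHomClass (SigmaSpec A) A ℂ where
  map_star φ := map_star φ.1

lemma measurable_apply (a : A) : Measurable fun φ : SigmaSpec A => φ a :=
  Measurable.of_comap_le (le_iSup (fun a : A =>
    MeasurableSpace.comap (fun φ : SigmaSpec A => φ a) inferInstance) a)

lemma measurable_of_apply {X : Type*} [MeasurableSpace X] {f : X → SigmaSpec A}
    (h : ∀ a, Measurable fun x => f x a) : Measurable f := by
  refine Measurable.of_le_map (iSup_le fun a => ?_)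
  rw [MeasurableSpace.comap_le_iff_le_map]
  exact (h a).le_map

lemma norm_apply_le (φ : SigmaSpec A) (a : A) : ‖φ a‖ ≤ ‖a‖ :=
  NonUnitalStarAlgHom.norm_apply_le φ.1 a

variable [StarOrderedRing A]

lemma monotone (φ : SigmaSpec A) : Monotone φ := OrderHomClass.mono φ.1

/-- Points of the `σ`-spectrum preserve suprema, expressed as limits. -/
lemma tendsto_of_isLUB (φ : SigmaSpec A) {a : ℕ → A} {s : A} (ha : IsBddMonoSeq a)
    (hs : IsLUB (Set.range a) s) :
    Filter.Tendsto (fun n => φ (a n)) Filter.atTop (nhds (φ s)) :=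
  Complex.tendsto_of_monotone_isLUB (fun _ _ h => φ.monotone (ha.monotone h)) (φ.2 a s ha hs)

end SigmaSpec

/-! ### The Gelfand transform is onto the bounded measurable functions -/

namespace CPureRep

variable {A : CPureRep.{u}}

/-- Representability concerns only positive elements, so it is applied to `star a * a`. Pure
`σ`-states are characters and vanish there as soon as they vanish at `a`. -/
lemma eq_zero_of_forall_spec {a : A} (h : ∀ φ : SigmaSpec A, φ a = 0) : a = 0 := by
  rw [← CStarRing.star_mul_self_eq_zero_iff]
  refine A.isPurelySigmaRepresentable _ (star_mul_self_nonneg a) fun φ hφ => ?_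
  let ψ : SigmaSpec A := ⟨hφ.toStarAlgHom, hφ.2⟩
  change ψ (star a * a) = 0
  rw [map_mul, h, mul_zero]

lemma ext_spec {a b : A} (h : ∀ φ : SigmaSpec A, φ a = φ b) : a = b :=
  sub_eq_zero.1 (eq_zero_of_forall_spec fun φ => by rw [map_sub, h, sub_self])

/-- A jointly injective family of star homomorphisms detects positivity, so the Gelfand transform is
an order embedding and suprema can be compared with pointwise limits. -/
lemma nonneg_iff {a : A} : 0 ≤ a ↔ ∀ φ : SigmaSpec A, 0 ≤ φ a :=
  ⟨fun h φ => by simpa using φ.monotone h, fun h => nonneg_of_jointly_injective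
    (fun φ : SigmaSpec A => (φ.1 : A →⋆ₙₐ[ℂ] ℂ)) (fun _ => eq_zero_of_forall_spec) h⟩

lemma le_iff {a b : A} : a ≤ b ↔ ∀ φ : SigmaSpec A, φ a ≤ φ b := by
  rw [← sub_nonneg, nonneg_iff]
  simp [sub_nonneg]

lemma isSelfAdjoint_iff {a : A} : IsSelfAdjoint a ↔ ∀ φ : SigmaSpec A, ((φ a).re : ℂ) = φ a := by
  constructor
  · intro h φ
    refine Complex.conj_eq_iff_re.1 ?_
    rw [← RCLike.star_def, ← map_star, h.star_eq]
  · intro h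
    refine ext_spec fun φ => ?_
    rw [map_star]
    exact Complex.conj_eq_iff_re.2 (h φ)

/-- Suprema in `A` are pointwise on the `σ`-spectrum. -/
lemma isLUB_of_tendsto {a : ℕ → A} (ha : Monotone a) {s : A}
    (hs : ∀ φ : SigmaSpec A, Filter.Tendsto (fun n => φ (a n)) Filter.atTop (nhds (φ s))) :
    IsLUB (Set.range a) s := by
  have h φ := isLUB_of_tendsto_atTop
    (show Monotone fun n => φ (a n) from fun m n h => φ.monotone (ha h)) (hs φ)
  refine ⟨?_, fun u hu => le_iff.2 fun φ => (h φ).2 ?_⟩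
  · rintro _ ⟨n, rfl⟩
    exact le_iff.2 fun φ => (h φ).1 ⟨n, rfl⟩
  · rintro _ ⟨n, rfl⟩
    exact φ.monotone (hu ⟨n, rfl⟩)

lemma isBddMonoSeq_of_forall {a : ℕ → A} {r : ℝ} (hr : 0 ≤ r)
    (hre : ∀ n (φ : SigmaSpec A), ((φ (a n)).re : ℂ) = φ (a n))
    (hmono : ∀ φ : SigmaSpec A, Monotone fun n => φ (a n))
    (hb : ∀ n (φ : SigmaSpec A), ‖φ (a n)‖ ≤ r) : IsBddMonoSeq a := by
  -- The order characterises the norm only for positive elements. The shift `a n + r` is positive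
  -- with norm at most `2 * r`, and undoing the shift costs another `r`.
  refine ⟨fun n => isSelfAdjoint_iff.2 (hre n),
    fun m n h => le_iff.2 fun φ => hmono φ h, r + r + r, fun n => ?_⟩
  have hrr : ∀ φ : SigmaSpec A, φ (algebraMap ℂ A r) = r := fun φ => AlgHomClass.commutes φ _
  have h0 : 0 ≤ a n + algebraMap ℂ A r := nonneg_iff.2 fun φ => by
    rw [map_add, hrr, ← hre]
    have := (abs_le.1 ((Complex.abs_re_le_norm _).trans (hb n φ))).1
    exact_mod_cast (by linarith : 0 ≤ (φ (a n)).re + r)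
  have h1 : ‖a n + algebraMap ℂ A r‖ ≤ r + r := by
    refine (CStarAlgebra.norm_le_iff_le_algebraMap _ (by linarith) h0).2 (le_iff.2 fun φ => ?_)
    rw [IsScalarTower.algebraMap_apply ℝ ℂ A, AlgHomClass.commutes, map_add, hrr, ← hre]
    have := (abs_le.1 ((Complex.abs_re_le_norm _).trans (hb n φ))).2
    change _ ≤ ((r + r : ℝ) : ℂ)
    exact_mod_cast (by linarith : (φ (a n)).re + r ≤ r + r)
  have h2 : ‖algebraMap ℂ A (r : ℂ)‖ ≤ r := by
    -- In the zero algebra the unit has norm `0`, so the formula for the norm of a scalar needs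
    -- nontriviality.
    by_cases hA : Subsingleton A
    · rw [Subsingleton.elim (algebraMap ℂ A r) 0, norm_zero]
      exact hr
    · rw [not_subsingleton_iff_nontrivial] at hA
      rw [norm_algebraMap', Complex.norm_real, Real.norm_of_nonneg hr]
  calc ‖a n‖ = ‖(a n + algebraMap ℂ A r) - algebraMap ℂ A (r : ℂ)‖ := by rw [add_sub_cancel_right]
    _ ≤ _ := (norm_sub_le _ _).trans (add_le_add h1 h2)

/-- Continuous functions of the Gelfand transform of an element are Gelfand transforms. -/
lemma exists_apply_eq_continuous (a : A) {f : ℂ → ℂ} (hf : Continuous f) :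
    ∃ b : A, ∀ φ : SigmaSpec A, φ b = f (φ a) := by
  let F : C(WeakDual.characterSpace ℂ A, ℂ) :=
    ⟨fun χ => f (χ a), hf.comp (WeakDual.gelfandTransform ℂ A a).continuous⟩
  refine ⟨(gelfandStarTransform A).symm F, fun φ => ?_⟩
  have h := (gelfandStarTransform A).apply_symm_apply F
  exact congrArg (fun G : C(WeakDual.characterSpace ℂ A, ℂ) =>
    G (WeakDual.CharacterSpace.equivAlgHom.symm (φ.1 : A →ₐ[ℂ] ℂ))) h

/-- A subset of the `σ`-spectrum is clopen if its indicator function is the Gelfand transform of an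
element. -/
def IsClopenSet (A : CPureRep.{u}) (E : Set (SigmaSpec A)) : Prop :=
  ∃ a : A, ∀ φ : SigmaSpec A, φ a = E.indicator (fun _ => 1) φ

/-- Here `σ`-completeness of `A` enters: the sequence has a supremum, and since points are
`σ`-normal its transform is the pointwise limit. -/
lemma exists_of_tendsto {a : ℕ → A} {r : ℝ} (hr : 0 ≤ r)
    (hre : ∀ n (φ : SigmaSpec A), ((φ (a n)).re : ℂ) = φ (a n))
    (hmono : ∀ φ : SigmaSpec A, Monotone fun n => φ (a n))
    (hb : ∀ n (φ : SigmaSpec A), ‖φ (a n)‖ ≤ r) {F : SigmaSpec A → ℂ}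
    (hF : ∀ φ, Filter.Tendsto (fun n => φ (a n)) Filter.atTop (nhds (F φ))) :
    ∃ s : A, ∀ φ : SigmaSpec A, φ s = F φ := by
  have hseq := isBddMonoSeq_of_forall hr hre hmono hb
  obtain ⟨s, hs⟩ := A.isSigmaComplete a hseq
  exact ⟨s, fun φ => tendsto_nhds_unique (φ.tendsto_of_isLUB hseq hs) (hF φ)⟩

lemma IsClopenSet.compl {E : Set (SigmaSpec A)} (h : IsClopenSet A E) : IsClopenSet A Eᶜ := by
  obtain ⟨a, ha⟩ := h
  refine ⟨1 - a, fun φ => ?_⟩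
  rw [map_sub, map_one, ha]
  by_cases hφ : φ ∈ E <;> simp [hφ]

lemma IsClopenSet.union {E F : Set (SigmaSpec A)} (hE : IsClopenSet A E) (hF : IsClopenSet A F) :
    IsClopenSet A (E ∪ F) := by
  obtain ⟨a, ha⟩ := hE
  obtain ⟨b, hb⟩ := hF
  refine ⟨a + b - a * b, fun φ => ?_⟩
  rw [map_sub, map_add, map_mul, ha, hb]
  by_cases h1 : φ ∈ E <;> by_cases h2 : φ ∈ F <;> simp [h1, h2]

/-- The indicators increase pointwise to that of the union, being eventually constant at each point.
-/
lemma isClopenSet_of_monotone {E : ℕ → Set (SigmaSpec A)} (hE : ∀ n, IsClopenSet A (E n))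
    (hmono : Monotone E) : IsClopenSet A (⋃ n, E n) := by
  choose a ha using hE
  refine exists_of_tendsto (a := a) zero_le_one (fun n φ => ?_) (fun φ m n hmn => ?_)
    (fun n φ => ?_) fun φ => ?_
  · rw [ha]
    by_cases h : φ ∈ E n <;> simp [h]
  · simp only [ha]
    exact Set.indicator_le_indicator_of_subset (hmono hmn) (fun _ => zero_le_one) φ
  · rw [ha]
    by_cases h : φ ∈ E n <;> simp [h]
  · simp only [ha]
    refine tendsto_const_nhds.congr' ?_
    by_cases h : φ ∈ ⋃ n, E n
    · obtain ⟨k, hk⟩ := Set.mem_iUnion.1 h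
      filter_upwards [Filter.eventually_ge_atTop k] with n hn
      rw [Set.indicator_of_mem h, Set.indicator_of_mem (hmono hn hk)]
    · refine Filter.Eventually.of_forall fun n => ?_
      simp only
      rw [Set.indicator_of_notMem h, Set.indicator_of_notMem]
      exact fun h' => h (Set.mem_iUnion.2 ⟨n, h'⟩)

lemma isClopenSet_empty : IsClopenSet A ∅ := ⟨0, fun φ => by simp⟩

/-- The clopen subsets of the `σ`-spectrum form a `σ`-algebra. -/
@[reducible]
def clopenMeasurableSpace (A : CPureRep.{u}) : MeasurableSpace (SigmaSpec A) where
  MeasurableSet' := IsClopenSet A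
  measurableSet_empty := isClopenSet_empty
  measurableSet_compl _ h := h.compl
  measurableSet_iUnion f hf := by
    -- Finite unions are clopen, so an arbitrary countable union may be replaced by an increasing
    -- one.
    rw [← Set.iUnion_accumulate]
    refine isClopenSet_of_monotone (fun n => ?_) Set.monotone_accumulate
    induction n with
    | zero =>
      rw [Set.accumulate_def]
      simpa using hf 0
    | succ n ih =>
      rw [Set.accumulate_succ]
      exact ih.union (hf _)

/-- The continuous functions `min 1 (n * dist (z, Uᶜ))` increase to the indicator of `U`; functional
calculus realises them in `A`. -/
lemma isClopenSet_preimage (a : A) {U : Set ℂ} (hU : IsOpen U) :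
    IsClopenSet A ((fun φ : SigmaSpec A => φ a) ⁻¹' U) := by
  -- The distance to the empty set is `0` by convention, so the approximation would fail for the
  -- whole plane.
  by_cases hne : U = Set.univ
  · subst hne
    exact ⟨1, fun φ => by simp⟩
  have hne' : Uᶜ.Nonempty := Set.nonempty_compl.2 hne
  let f : ℕ → ℂ → ℝ := fun n z => min 1 (n * Metric.infDist z Uᶜ)
  have hf : ∀ n, Continuous fun z => ((f n z : ℝ) : ℂ) := fun n =>
    Complex.continuous_ofReal.comp (by fun_prop)
  have hf0 : ∀ n z, 0 ≤ f n z := fun n z =>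
    le_min zero_le_one (mul_nonneg n.cast_nonneg Metric.infDist_nonneg)
  choose b hb using fun n => exists_apply_eq_continuous a (hf n)
  refine exists_of_tendsto (a := b) zero_le_one (fun n φ => ?_) (fun φ m n hmn => ?_)
    (fun n φ => ?_) fun φ => ?_
  · rw [hb, Complex.ofReal_re]
  · simp only [hb]
    refine Complex.real_le_real.2 (min_le_min le_rfl (mul_le_mul_of_nonneg_right ?_
      Metric.infDist_nonneg))
    exact_mod_cast hmn
  · rw [hb, Complex.norm_real, Real.norm_of_nonneg (hf0 _ _)]
    exact min_le_left _ _
  · simp only [hb]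
    refine tendsto_const_nhds.congr' ?_
    by_cases h : φ a ∈ U
    · have hpos : 0 < Metric.infDist (φ a) Uᶜ :=
        (hU.isClosed_compl.notMem_iff_infDist_pos hne').1 (by simpa using h)
      obtain ⟨k, hk⟩ := exists_nat_gt (Metric.infDist (φ a) Uᶜ)⁻¹
      filter_upwards [Filter.eventually_ge_atTop k] with n hn
      have h1 : 1 ≤ n * Metric.infDist (φ a) Uᶜ := by
        rw [← div_le_iff₀ hpos, one_div]
        exact hk.le.trans (by exact_mod_cast hn)
      rw [Set.indicator_of_mem (by exact h), show f n (φ a) = 1 from min_eq_left h1,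
        Complex.ofReal_one]
    · refine Filter.Eventually.of_forall fun n => ?_
      simp only
      rw [Set.indicator_of_notMem (by exact h)]
      have : Metric.infDist (φ a) Uᶜ = 0 := Metric.infDist_zero_of_mem h
      simp [f, this]

/-- The clopen sets form a `σ`-algebra for which all evaluations are measurable, and the `σ`-algebra
of the spectrum is the smallest such. -/
lemma isClopenSet_of_measurableSet {E : Set (SigmaSpec A)} (hE : MeasurableSet E) :
    IsClopenSet A E := by
  have : (inferInstance : MeasurableSpace (SigmaSpec A)) ≤ clopenMeasurableSpace A := by
    refine iSup_le fun a => ?_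
    rw [MeasurableSpace.comap_le_iff_le_map, BorelSpace.measurable_eq (α := ℂ), borel]
    exact MeasurableSpace.generateFrom_le fun U hU => isClopenSet_preimage a hU
  exact this E hE

variable (A)

/-- The Gelfand transform `A → 𝓛^∞(Spec A)`. -/
noncomputable def gelfand : A →⋆ₐ[ℂ] LInfty (SigmaSpec A) where
  toFun a := LInfty.mk (fun φ => φ a) (SigmaSpec.measurable_apply a) ‖a‖ fun φ => φ.norm_apply_le a
  map_one' := LInfty.ext fun φ => map_one φ
  map_mul' a b := LInfty.ext fun φ => map_mul φ a b
  map_zero' := LInfty.ext fun φ => map_zero φ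
  map_add' a b := LInfty.ext fun φ => map_add φ a b
  commutes' c := LInfty.ext fun φ => AlgHomClass.commutes φ c
  map_star' a := LInfty.ext fun φ => map_star φ a

variable {A}

lemma gelfand_injective : Function.Injective (gelfand A) := fun _ _ h =>
  ext_spec fun φ => congrArg (fun f : LInfty (SigmaSpec A) => f φ) h

/-- The range contains all indicators of measurable sets. It is closed under bounded monotone
suprema, since preimages of such a sequence are again bounded and monotone. -/
lemma gelfand_surjective : Function.Surjective (gelfand A) := by
  suffices h : LinearMap.range (gelfand A : A →ₗ[ℂ] LInfty (SigmaSpec A)) = ⊤ from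
    LinearMap.range_eq_top.1 h
  refine LInfty.eq_top_of_ind_mem (fun b s hb hmem hs => ?_) fun E hE => ?_
  · choose a ha using hmem
    have ha' : ∀ n (φ : SigmaSpec A), φ (a n) = b n φ := fun n φ =>
      congrArg (fun f : LInfty (SigmaSpec A) => f φ) (ha n)
    obtain ⟨r, hr⟩ := hb.bounded
    obtain ⟨t, ht⟩ := exists_of_tendsto (a := a) ((norm_nonneg _).trans (hr 0))
      (fun n φ => by rw [ha', LInfty.isSelfAdjoint_iff.1 (hb.isSelfAdjoint n)])
      (fun φ m n hmn => by simpa only [ha'] using hb.monotone hmn φ)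
      (fun n φ => by rw [ha']; exact ((b n).norm_apply_le φ).trans (hr n)) (F := s) fun φ => by
        simpa only [ha'] using LInfty.tendsto_of_isLUB hb hs φ
    exact ⟨t, LInfty.ext ht⟩
  · obtain ⟨a, ha⟩ := isClopenSet_of_measurableSet hE
    exact ⟨a, LInfty.ext ha⟩

end CPureRep

/-! ### `σ`-normal states as probability measures -/

namespace LInfty

variable {X Y : Type u} [MeasurableSpace X] [MeasurableSpace Y]

lemma tendsto_state {ν : LInfty X →ₗ[ℂ] ℂ} (hν : ν ∈ states (LInfty X)) (hn : SigmaNormal ν)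
    {a : ℕ → LInfty X} {s : LInfty X} (ha : IsBddMonoSeq a) (hs : IsLUB (Set.range a) s) :
    Filter.Tendsto (fun n => ν (a n)) Filter.atTop (nhds (ν s)) := by
  refine Complex.tendsto_of_monotone_isLUB (fun m n h => ?_) (hn a s ha hs)
  rw [← sub_nonneg, ← map_sub]
  exact hν.1 _ (sub_nonneg.2 (ha.monotone h))

lemma ind_nonneg {E : Set X} (hE : MeasurableSet E) : 0 ≤ ind hE := fun x =>
  Set.indicator_nonneg (fun _ _ => zero_le_one) x

lemma state_ind_eq_re {ν : LInfty X →ₗ[ℂ] ℂ} (hν : ν ∈ states (LInfty X)) {E : Set X}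
    (hE : MeasurableSet E) : ν (ind hE) = ((ν (ind hE)).re : ℂ) := by
  have := (Complex.le_def.1 (hν.1 _ (ind_nonneg hE))).2
  exact Complex.ext rfl (by simpa using this.symm)

lemma state_ind_re_nonneg {ν : LInfty X →ₗ[ℂ] ℂ} (hν : ν ∈ states (LInfty X)) {E : Set X}
    (hE : MeasurableSet E) : 0 ≤ (ν (ind hE)).re :=
  (Complex.le_def.1 (hν.1 _ (ind_nonneg hE))).1

/-- The measure that represents a `σ`-normal state on `𝓛^∞(X)`. -/
noncomputable def stateMeasure (ν : LInfty X →ₗ[ℂ] ℂ) (hν : ν ∈ states (LInfty X))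
    (hn : SigmaNormal ν) : Measure X :=
  Measure.ofMeasurable (fun _ hE => ENNReal.ofReal (ν (ind hE)).re)
    (by
      have : ind (X := X) MeasurableSet.empty = 0 := by ext x; simp [ind_apply]
      rw [this, map_zero, Complex.zero_re, ENNReal.ofReal_zero])
    (fun f hm hd => by
      -- The indicator of the union is the supremum of the partial sums, so `σ`-normality is exactly
      -- countable additivity.
      obtain ⟨h1, h2⟩ := ind_iUnion hm hd
      have h3 := (Complex.continuous_re.tendsto _).comp (tendsto_state hν hn h1 h2)
      have h4 := (ENNReal.continuous_ofReal.tendsto _).comp h3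
      refine tendsto_nhds_unique h4 ?_
      have h5 := ENNReal.tendsto_nat_tsum fun i => ENNReal.ofReal (ν (ind (hm i))).re
      refine h5.congr fun n => ?_
      rw [← ENNReal.ofReal_sum_of_nonneg fun i _ => state_ind_re_nonneg hν (hm i)]
      simp only [Function.comp_apply]
      rw [map_sum, Complex.re_sum])

lemma stateMeasure_apply {ν : LInfty X →ₗ[ℂ] ℂ} (hν : ν ∈ states (LInfty X))
    (hn : SigmaNormal ν) {E : Set X} (hE : MeasurableSet E) :
    stateMeasure ν hν hn E = ENNReal.ofReal (ν (ind hE)).re :=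
  Measure.ofMeasurable_apply E hE

lemma ind_univ : ind (X := X) MeasurableSet.univ = 1 := by ext x; simp [ind_apply]

instance {ν : LInfty X →ₗ[ℂ] ℂ} (hν : ν ∈ states (LInfty X)) (hn : SigmaNormal ν) :
    IsProbabilityMeasure (stateMeasure ν hν hn) where
  measure_univ := by
    rw [stateMeasure_apply hν hn MeasurableSet.univ, ind_univ, hν.2, Complex.one_re,
      ENNReal.ofReal_one]

lemma tendsto_integral_of_isLUB (μ : Measure X) [IsProbabilityMeasure μ]
    {a : ℕ → LInfty X} {s : LInfty X} (ha : IsBddMonoSeq a) (hs : IsLUB (Set.range a) s) :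
    Filter.Tendsto (fun n => ∫ x, a n x ∂μ) Filter.atTop (nhds (∫ x, s x ∂μ)) := by
  obtain ⟨r, hr⟩ := ha.bounded
  exact tendsto_integral_of_dominated_convergence (fun _ => r)
    (fun n => (a n).measurable.aestronglyMeasurable) (integrable_const r)
    (fun n => Filter.Eventually.of_forall fun y => ((a n).norm_apply_le y).trans (hr n))
    (Filter.Eventually.of_forall fun y => tendsto_of_isLUB ha hs y)

/-- Integration against a probability measure. -/
noncomputable def integralLinear (μ : Measure X) [IsProbabilityMeasure μ] : LInfty X →ₗ[ℂ] ℂ where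
  toFun f := ∫ x, f x ∂μ
  map_add' f g := integral_add (integrable μ f) (integrable μ g)
  map_smul' c f := integral_const_mul c fun y => f y

lemma integral_ind (μ : Measure X) {E : Set X} (hE : MeasurableSet E) :
    ∫ x, ind hE x ∂μ = (μ.real E : ℂ) := by
  simp only [ind_apply]
  rw [integral_indicator_const _ hE]
  simp

/-- The functionals agree on indicators by construction. Their equaliser is closed under bounded
monotone suprema, by dominated convergence on one side and `σ`-normality on the other. -/
lemma integral_stateMeasure {ν : LInfty X →ₗ[ℂ] ℂ} (hν : ν ∈ states (LInfty X))
    (hn : SigmaNormal ν) (f : LInfty X) : ∫ x, f x ∂(stateMeasure ν hν hn) = ν f := by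
  have : LinearMap.eqLocus (integralLinear (stateMeasure ν hν hn)) ν = ⊤ := by
    refine eq_top_of_ind_mem (fun b s hb hmem hs => ?_) fun E hE => ?_
    · refine tendsto_nhds_unique (tendsto_integral_of_isLUB (stateMeasure ν hν hn) hb hs) ?_
      exact (tendsto_state hν hn hb hs).congr fun n => (hmem n).symm
    · change ∫ x, ind hE x ∂(stateMeasure ν hν hn) = _
      rw [integral_ind, measureReal_def, stateMeasure_apply hν hn hE,
        ENNReal.toReal_ofReal (state_ind_re_nonneg hν hE), ← state_ind_eq_re hν hE]
  exact LinearMap.congr_fun (LinearMap.eqLocus_eq_top.1 this) f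

lemma measure_ext {μ ν : Measure X} [IsProbabilityMeasure μ] [IsProbabilityMeasure ν]
    (h : ∀ f : LInfty X, ∫ x, f x ∂μ = ∫ x, f x ∂ν) : μ = ν := by
  ext E hE
  have := h (ind hE)
  rw [integral_ind, integral_ind] at this
  exact (measureReal_eq_measureReal_iff).1 (by exact_mod_cast this)

lemma integral_dirac_eq (f : LInfty X) (x : X) : ∫ y, f y ∂(Measure.dirac x) = f x :=
  integral_dirac' _ _ f.measurable.stronglyMeasurable

lemma kernel_ext {κ η : Kernel X Y} [IsMarkovKernel κ] [IsMarkovKernel η]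
    (h : ∀ (f : LInfty Y) (x : X), ∫ y, f y ∂κ x = ∫ y, f y ∂η x) : κ = η :=
  Kernel.ext fun x => measure_ext fun f => h f x

end LInfty

/-! ### Markov kernels from `σ`-cpu maps -/

namespace SigmaCPU

variable {A B : Type*} [CStarAlgebra A] [PartialOrder A] [StarOrderedRing A]
  [CStarAlgebra B] [PartialOrder B] [StarOrderedRing B]

instance : LinearMapClass (SigmaCPU A B) ℂ A B where
  map_add f := map_add f.toLinearMap
  map_smulₛₗ f := map_smul f.toLinearMap

@[simp] lemma map_one (f : SigmaCPU A B) : f 1 = 1 := f.map_one'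

lemma sigmaNormal (f : SigmaCPU A B) : SigmaNormal f := f.sigmaNormal'

lemma comp_mem_states (f : SigmaCPU A B) {ν : B →ₗ[ℂ] ℂ} (hν : ν ∈ states B) :
    ν ∘ₗ f.toLinearMap ∈ states A :=
  ⟨fun a ha => hν.1 _ (by simpa using! f.monotone ha), (congrArg ν f.map_one').trans hν.2⟩

lemma comp_sigmaNormal (f : SigmaCPU A B) {ν : B →ₗ[ℂ] ℂ} (hν : SigmaNormal ν) :
    SigmaNormal (ν ∘ₗ f.toLinearMap) :=
  fun _ _ ha hs => hν _ _ (f.isBddMonoSeq ha) (f.sigmaNormal _ _ ha hs)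

end SigmaCPU

namespace SigmaSpec

variable {A : Type u} [CommCStarAlgebra A] [PartialOrder A]

/-- A point of the `σ`-spectrum as a linear functional. -/
def toLinear (φ : SigmaSpec A) : A →ₗ[ℂ] ℂ := φ.1.toAlgHom.toLinearMap

@[simp] lemma toLinear_apply (φ : SigmaSpec A) (a : A) : φ.toLinear a = φ a := rfl

lemma toLinear_sigmaNormal (φ : SigmaSpec A) : SigmaNormal φ.toLinear := φ.2

variable [StarOrderedRing A]

lemma toLinear_mem_states (φ : SigmaSpec A) : φ.toLinear ∈ states A :=
  ⟨fun a ha => by simpa using φ.monotone ha, _root_.map_one φ⟩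

variable {X : Type u} [MeasurableSpace X]

/-- The Markov kernel from the `σ`-spectrum of `A` to `X` associated to a `σ`-cpu map
`𝓛^∞(X) → A`. -/
noncomputable def kernel (f : SigmaCPU (LInfty X) A) : Kernel (SigmaSpec A) X where
  toFun ψ := LInfty.stateMeasure (ψ.toLinear ∘ₗ f.toLinearMap)
    (f.comp_mem_states ψ.toLinear_mem_states) (f.comp_sigmaNormal ψ.toLinear_sigmaNormal)
  measurable' := by
    -- The mass of `E` at `ψ` is the real part of the evaluation of `ψ` at the fixed element `f (ind
    -- E)`, hence measurable in `ψ`.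
    refine Measure.measurable_of_measurable_coe _ fun E hE => ?_
    simp_rw [LInfty.stateMeasure_apply _ _ hE]
    exact (Complex.measurable_re.comp (measurable_apply (f (LInfty.ind hE)))).ennreal_ofReal

instance (f : SigmaCPU (LInfty X) A) : IsMarkovKernel (kernel f) where
  isProbabilityMeasure ψ := by
    exact inferInstanceAs (IsProbabilityMeasure
      (LInfty.stateMeasure (ψ.toLinear ∘ₗ f.toLinearMap) (f.comp_mem_states ψ.toLinear_mem_states)
        (f.comp_sigmaNormal ψ.toLinear_sigmaNormal)))

lemma integral_kernel (f : SigmaCPU (LInfty X) A) (ψ : SigmaSpec A) (g : LInfty X) :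
    ∫ x, g x ∂(kernel f ψ) = ψ (f g) :=
  LInfty.integral_stateMeasure (f.comp_mem_states ψ.toLinear_mem_states)
    (f.comp_sigmaNormal ψ.toLinear_sigmaNormal) g

end SigmaSpec

/-- Positive maps into commutative C⋆-algebras that are given by star homomorphisms. -/
lemma nonneg_map_of_starAlgHom {A B : Type*} [CStarAlgebra A] [PartialOrder A] [StarOrderedRing A]
    [CStarAlgebra B] [PartialOrder B] [StarOrderedRing B] (f : A →⋆ₐ[ℂ] B) (k : ℕ)
    (M : CStarMatrix (Fin k) (Fin k) A) (hM : 0 ≤ M) : 0 ≤ M.map f :=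
  map_nonneg (CStarMatrix.mapₙₐ (f : A →⋆ₙₐ[ℂ] B) : CStarMatrix (Fin k) (Fin k) A →⋆ₙₐ[ℂ]
    CStarMatrix (Fin k) (Fin k) B) hM

/-- A `σ`-normal star homomorphism is a `σ`-cpu map. -/
noncomputable def SigmaCPU.ofStarAlgHom {A B : Type*} [CStarAlgebra A] [PartialOrder A]
    [StarOrderedRing A] [CStarAlgebra B] [PartialOrder B] [StarOrderedRing B] (f : A →⋆ₐ[ℂ] B)
    (hf : SigmaNormal f) : SigmaCPU A B where
  toLinearMap := f.toAlgHom.toLinearMap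
  map_cstarMatrix_nonneg' := nonneg_map_of_starAlgHom f
  map_one' := _root_.map_one f
  sigmaNormal' := hf

namespace CPureRep

variable (A : CPureRep.{u})

/-- The Gelfand transform as an isomorphism of star algebras. -/
noncomputable def gelfandEquiv : A ≃⋆ₐ[ℂ] LInfty (SigmaSpec A) :=
  StarAlgEquiv.ofBijective (gelfand A) ⟨gelfand_injective, gelfand_surjective⟩

variable {A}

@[simp] lemma gelfandEquiv_apply (a : A) (φ : SigmaSpec A) : gelfandEquiv A a φ = φ a := rfl

@[simp] lemma apply_gelfandEquiv_symm (f : LInfty (SigmaSpec A)) (φ : SigmaSpec A) :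
    φ ((gelfandEquiv A).symm f) = f φ := by
  rw [← gelfandEquiv_apply, StarAlgEquiv.apply_symm_apply]

lemma gelfandEquiv_le_iff {a b : A} : gelfandEquiv A a ≤ gelfandEquiv A b ↔ a ≤ b :=
  le_iff.symm

lemma sigmaNormal_gelfandEquiv : SigmaNormal (gelfandEquiv A) := fun _ _ ha hs =>
  LInfty.isLUB_of_tendsto (fun _ _ h => gelfandEquiv_le_iff.2 (ha.monotone h)) fun φ =>
    φ.tendsto_of_isLUB ha hs

lemma sigmaNormal_gelfandEquiv_symm : SigmaNormal (gelfandEquiv A).symm := fun a s ha hs => by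
  refine isLUB_of_tendsto (fun m n h => ?_) fun φ => ?_
  · rw [← gelfandEquiv_le_iff, StarAlgEquiv.apply_symm_apply, StarAlgEquiv.apply_symm_apply]
    exact ha.monotone h
  · simpa using LInfty.tendsto_of_isLUB ha hs φ

variable (A)

/-- The Gelfand transform as a `σ`-cpu map. -/
noncomputable def gelfandHom : SigmaCPU A (LInfty (SigmaSpec A)) :=
  .ofStarAlgHom (gelfandEquiv A : A →⋆ₐ[ℂ] LInfty (SigmaSpec A)) sigmaNormal_gelfandEquiv

/-- The inverse of the Gelfand transform as a `σ`-cpu map. -/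
noncomputable def gelfandInv : SigmaCPU (LInfty (SigmaSpec A)) A :=
  .ofStarAlgHom ((gelfandEquiv A).symm : LInfty (SigmaSpec A) →⋆ₐ[ℂ] A)
    sigmaNormal_gelfandEquiv_symm

variable {A}

@[simp] lemma apply_gelfandInv (f : LInfty (SigmaSpec A)) (φ : SigmaSpec A) :
    φ (gelfandInv A f) = f φ := apply_gelfandEquiv_symm f φ

@[simp] lemma gelfandInv_gelfandHom (a : A) : gelfandInv A (gelfandHom A a) = a :=
  (gelfandEquiv A).symm_apply_apply a

@[simp] lemma gelfandHom_gelfandInv (f : LInfty (SigmaSpec A)) :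
    gelfandHom A (gelfandInv A f) = f :=
  (gelfandEquiv A).apply_symm_apply f

end CPureRep

/-! ### The functor `Spec` and the equivalence -/

/-- A morphism of `Stoch` from a Markov kernel. -/
noncomputable def stochHom {X Y : Stoch.{u}} (κ : Kernel X.obj Y.obj) (hκ : IsMarkovKernel κ) :
    X ⟶ Y :=
  ⟨⟨κ, inferInstance⟩, hκ⟩

/-- The action of a morphism of `Stoch` on bounded measurable functions. -/
noncomputable def koop {X Y : Stoch.{u}} (κ : X ⟶ Y) : SigmaCPU (LInfty Y.obj) (LInfty X.obj) :=
  LInfty.koopman κ.hom.hom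

section Koop

variable {X Y Z : Stoch.{u}}

/-- Indicators are among the test functions, so the action on functions is faithful; equations
between kernels are checked there. -/
lemma stoch_hom_ext {κ η : X ⟶ Y} (h : ∀ f x, koop κ f x = koop η f x) : κ = η := by
  ext : 2
  exact LInfty.kernel_ext h

@[simp] lemma koop_comp (κ : X ⟶ Y) (η : Y ⟶ Z) (f : LInfty Z.obj) :
    koop (κ ≫ η) f = koop κ (koop η f) :=
  LInfty.ext fun _ => Kernel.integral_comp (κ := κ.hom.hom) (η := η.hom.hom) (LInfty.integrable _ f)

@[simp] lemma koop_id (f : LInfty X.obj) : koop (𝟙 X) f = f := by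
  ext x
  change ∫ y, f y ∂(Kernel.id x) = f x
  rw [Kernel.id_apply, LInfty.integral_dirac_eq]

lemma koop_stochHom (κ : Kernel X.obj Y.obj) (hκ : IsMarkovKernel κ) (f : LInfty Y.obj)
    (x : X.obj) : koop (stochHom κ hκ) f x = ∫ y, f y ∂(κ x) := rfl

/-- The morphism of `Stoch` given by a measurable function. -/
noncomputable def stochDet (p : X.obj → Y.obj) (hp : Measurable p) : X ⟶ Y :=
  stochHom (Kernel.deterministic p hp) inferInstance

@[simp] lemma koop_stochDet (p : X.obj → Y.obj) (hp : Measurable p) (f : LInfty Y.obj) (x : X.obj) :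
    koop (stochDet p hp) f x = f (p x) := by
  rw [stochDet, koop_stochHom, Kernel.deterministic_apply, LInfty.integral_dirac_eq]

end Koop

namespace CPureRep

variable {A B C : CPureRep.{u}}

/-- The Markov kernel associated to a `σ`-cpu map. -/
noncomputable def specMap (f : A ⟶ B) : specObj B ⟶ specObj A :=
  stochHom (X := specObj B) (Y := specObj A)
    (SigmaSpec.kernel (SigmaCPU.comp (A := LInfty (SigmaSpec A)) (B := A) (C := B) f (gelfandInv A)))
    (SigmaSpec.instIsMarkovKernelKernel _)

lemma koop_specMap (f : A ⟶ B) (g : LInfty (SigmaSpec A)) (ψ : SigmaSpec B) :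
    koop (specMap f) g ψ = ψ (f (gelfandInv A g)) :=
  SigmaSpec.integral_kernel _ ψ g

lemma koop_specMap' (f : A ⟶ B) (g : LInfty (SigmaSpec A)) :
    koop (specMap f) g = gelfandHom B (f (gelfandInv A g)) :=
  LInfty.ext (koop_specMap f g)

end CPureRep

/-- The Gelfand transform with values in the algebra of the object `specObj A`. -/
noncomputable def gel (A : CPureRep.{u}) (a : A) : LInfty (specObj A).obj :=
  CPureRep.gelfandHom A a

/-- The inverse of the Gelfand transform on the algebra of the object `specObj A`. -/
noncomputable def ungel (A : CPureRep.{u}) (f : LInfty (specObj A).obj) : A :=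
  CPureRep.gelfandInv A f

/-- A bounded measurable function as an element of the object `LInftyFunctor.obj X`. -/
def toObj {X : Stoch.{u}} (f : LInfty X.obj) : (LInftyFunctor.obj X).unop := f

/-- An element of the object `LInftyFunctor.obj X` as a bounded measurable function. -/
def ofObj {X : Stoch.{u}} (f : (LInftyFunctor.obj X).unop) : LInfty X.obj := f

section Gel

variable {A B : CPureRep.{u}} {X Y : Stoch.{u}}

@[simp] lemma gel_ungel (f : LInfty (specObj A).obj) : gel A (ungel A f) = f :=
  CPureRep.gelfandHom_gelfandInv (A := A) f

@[simp] lemma ofObj_toObj (f : LInfty X.obj) : ofObj (toObj f) = f := rfl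

@[simp] lemma toObj_ofObj (f : (LInftyFunctor.obj X).unop) : toObj (ofObj f) = f := rfl

-- Under the Gelfand transform the kernel of `f` acts as `f`. Functoriality of the spectrum and
-- naturality of unit and counit all reduce to this identity.
@[simp] lemma koop_specMap_gel (f : A ⟶ B) (a : A) :
    koop (CPureRep.specMap f) (gel A a) = gel B (f a) :=
  (CPureRep.koop_specMap' f (CPureRep.gelfandHom A a)).trans
    (by rw [CPureRep.gelfandInv_gelfandHom]; rfl)

/-- Every function on the spectrum is a Gelfand transform, so these suffice as test functions. -/
lemma specObj_hom_ext {κ η : X ⟶ specObj A}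
    (h : ∀ a : A, koop κ (gel A a) = koop η (gel A a)) : κ = η :=
  stoch_hom_ext fun f x => by
    have := congrArg (fun g : LInfty X.obj => g x) (h (ungel A f))
    simpa using this

@[simp] lemma map_unop_apply (κ : X ⟶ Y) (f : (LInftyFunctor.obj Y).unop) :
    (LInftyFunctor.map κ).unop f = toObj (koop κ (ofObj f)) := rfl

/-- The morphism `x ↦ δ_{ev_x}` from `X` to the `σ`-spectrum of its algebra. -/
noncomputable def evalHom (X : Stoch.{u}) : X ⟶ specObj (LInftyFunctor.obj X).unop :=
  stochDet (Y := specObj (LInftyFunctor.obj X).unop) (fun x => evalPoint x)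
    (SigmaSpec.measurable_of_apply fun a => LInfty.measurable (X := X.obj) a)

/-- The Markov kernel from the `σ`-spectrum of `𝓛^∞(X)` to `X`. -/
noncomputable def evalInv (X : Stoch.{u}) : specObj (LInftyFunctor.obj X).unop ⟶ X :=
  stochHom (X := specObj (LInftyFunctor.obj X).unop)
    (SigmaSpec.kernel (A := (LInftyFunctor.obj X).unop) (SigmaCPU.id (LInfty X.obj)))
    (SigmaSpec.instIsMarkovKernelKernel _)

-- Together with `koop_evalInv`, this shows that the two kernels act on functions as mutually
-- inverse maps. That suffices for an isomorphism in `Stoch`, whether or not `x ↦ ev_x` is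
-- bijective.
@[simp] lemma koop_evalHom_gel (f : (LInftyFunctor.obj X).unop) :
    koop (evalHom X) (gel _ f) = ofObj f :=
  LInfty.ext fun x => koop_stochDet (Y := specObj (LInftyFunctor.obj X).unop) _ _ (gel _ f) x

@[simp] lemma koop_evalInv (f : LInfty X.obj) : koop (evalInv X) f = gel _ (toObj f) :=
  LInfty.ext fun ψ => SigmaSpec.integral_kernel (A := (LInftyFunctor.obj X).unop) _ ψ f

end Gel

/-- The action of the Gelfand `σ`-spectrum on `σ`-cpu maps. -/
noncomputable def sigmaSpecAction : SigmaSpecAction.{u} where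
  map f := CPureRep.specMap f
  map_id A := specObj_hom_ext fun a => by
    rw [koop_specMap_gel, koop_id]
    rfl
  map_comp {A B C} f g := specObj_hom_ext fun a => by
    rw [koop_specMap_gel, koop_comp, koop_specMap_gel, koop_specMap_gel]
    rfl
  integral_map {A B} f ψ a :=
    congrArg (fun h : LInfty (specObj B).obj => h ψ) (koop_specMap_gel f a)

/-- The isomorphism between `X` and the `σ`-spectrum of its algebra. -/
noncomputable def evalIsoApp (X : Stoch.{u}) : X ≅ specObj (LInftyFunctor.obj X).unop where
  hom := evalHom X
  inv := evalInv X
  hom_inv_id := stoch_hom_ext fun f x => by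
    rw [koop_comp, koop_evalInv, koop_evalHom_gel, koop_id, ofObj_toObj]
  inv_hom_id := specObj_hom_ext fun a => by
    rw [koop_comp, koop_evalHom_gel, koop_evalInv, toObj_ofObj, koop_id]

/-- The unit of the equivalence. -/
noncomputable def evalIso : 𝟭 Stoch.{u} ≅ LInftyFunctor.{u} ⋙ sigmaSpecAction.functor :=
  NatIso.ofComponents evalIsoApp
    (fun {X Y} κ => specObj_hom_ext (X := X) (A := (LInftyFunctor.obj Y).unop) fun a => by
      refine (koop_comp κ (evalHom Y) _).trans (Eq.trans ?_ (koop_comp (evalHom X)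
        (CPureRep.specMap (LInftyFunctor.map κ).unop) _).symm)
      rw [koop_evalHom_gel, koop_specMap_gel, koop_evalHom_gel, map_unop_apply, ofObj_toObj])

/-- The Gelfand transform as an isomorphism. -/
noncomputable def gelfandIso (A : CPureRep.{u}) :
    A ≅ (LInftyFunctor.obj (specObj A)).unop where
  hom := CPureRep.gelfandHom A
  inv := CPureRep.gelfandInv A
  hom_inv_id := SigmaCPU.ext (A := A) (B := A) fun a => CPureRep.gelfandInv_gelfandHom a
  inv_hom_id := SigmaCPU.ext (A := LInfty (SigmaSpec A)) (B := LInfty (SigmaSpec A)) fun f =>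
    CPureRep.gelfandHom_gelfandInv f

lemma hom_ext {A B : CPureRep.{u}} {f g : A ⟶ B} (h : ∀ a : A, f a = g a) : f = g :=
  SigmaCPU.ext (A := A) (B := B) h

/-- The counit of the equivalence. -/
noncomputable def gelfandNatIso :
    sigmaSpecAction.functor ⋙ LInftyFunctor.{u} ≅ 𝟭 CPureRep.{u}ᵒᵖ :=
  NatIso.ofComponents (fun A => (gelfandIso A.unop).op) (fun {A B} f => by
    apply Quiver.Hom.unop_inj
    refine hom_ext fun a => ?_
    exact koop_specMap_gel f.unop a)

lemma evalIso_gelfandNatIso_triangle (X : Stoch.{u}) :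
    LInftyFunctor.map (evalIso.hom.app X) ≫ gelfandNatIso.hom.app (LInftyFunctor.obj X) = 𝟙 _ := by
  apply Quiver.Hom.unop_inj
  exact hom_ext fun a => koop_evalHom_gel a

/-- The equivalence between `Stoch` and the opposite of the category of commutative purely
`σ`-representable `σC⋆`-algebras. -/
noncomputable def stochEquivalence : Stoch.{u} ≌ CPureRep.{u}ᵒᵖ :=
  Equivalence.mk' LInftyFunctor sigmaSpecAction.functor evalIso gelfandNatIso
    evalIso_gelfandNatIso_triangle

lemma evalIso_hom_app_apply (X : Stoch.{u}) (x : X.obj) :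
    (evalIso.hom.app X).hom.hom x = Measure.dirac (evalPoint x) :=
  Kernel.deterministic_apply (SigmaSpec.measurable_of_apply fun a => LInfty.measurable (X := X.obj) a) x

lemma linftyEval_gelfandNatIso (A : CPureRep.{u}) (a : A) (φ : SigmaSpec A) :
    linftyEval (X := specObj A) ((gelfandNatIso.hom.app (op A)).unop a) φ = φ a := rfl

/-! ### Bounded measurable functions on products -/

/-- Measurable sets of a product are unions of measurable rectangles. -/
lemma exists_rectangle_of_measurableSet {X Y : Type*} [MeasurableSpace X] [MeasurableSpace Y]
    {S : Set (X × Y)} (hS : MeasurableSet S) (p : X × Y) :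
    ∃ (E : Set X) (F : Set Y), MeasurableSet E ∧ MeasurableSet F ∧ p.1 ∈ E ∧ p.2 ∈ F ∧
      ∀ x ∈ E, ∀ y ∈ F, ((x, y) ∈ S ↔ p ∈ S) := by
  -- The two-sided condition, that membership is constant on a rectangle around `p`, is stable under
  -- complements. For countable unions the rectangles are intersected.
  induction S, hS using MeasurableSpace.induction_on_inter generateFrom_prod.symm isPiSystem_prod
  with
  | empty => exact ⟨Set.univ, Set.univ, .univ, .univ, trivial, trivial, by simp⟩
  | basic S hS =>
    obtain ⟨E, hE, F, hF, rfl⟩ := hS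
    by_cases h1 : p.1 ∈ E
    · by_cases h2 : p.2 ∈ F
      · exact ⟨E, F, hE, hF, h1, h2, fun x hx y hy => by simp [hx, hy, h1, h2, Set.mem_prod]⟩
      · exact ⟨Set.univ, Fᶜ, .univ, MeasurableSet.compl hF, trivial, h2, fun x _ y hy => by
          have : y ∉ F := hy
          simp [Set.mem_prod, this, h2]⟩
    · exact ⟨Eᶜ, Set.univ, MeasurableSet.compl hE, .univ, h1, trivial, fun x hx y _ => by
        have : x ∉ E := hx
        simp [Set.mem_prod, this, h1]⟩
  | compl S hS ih =>
    obtain ⟨E, F, hE, hF, h1, h2, h⟩ := ih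
    exact ⟨E, F, hE, hF, h1, h2, fun x hx y hy => not_congr (h x hx y hy)⟩
  | iUnion S _ _ ih =>
    choose E F hE hF h1 h2 h using ih
    refine ⟨⋂ n, E n, ⋂ n, F n, .iInter hE, .iInter hF, Set.mem_iInter.2 h1, Set.mem_iInter.2 h2,
      fun x hx y hy => ?_⟩
    simp only [Set.mem_iUnion]
    exact exists_congr fun n => h n x (Set.mem_iInter.1 hx n) y (Set.mem_iInter.1 hy n)

/-- A measurable function on a product is constant on a measurable rectangle around each point. -/
lemma exists_rectangle_eq {X Y Z : Type*} [MeasurableSpace X] [MeasurableSpace Y]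
    [MeasurableSpace Z] [MeasurableSingletonClass Z] {f : X × Y → Z} (hf : Measurable f)
    (p : X × Y) : ∃ (E : Set X) (F : Set Y), MeasurableSet E ∧ MeasurableSet F ∧ p.1 ∈ E ∧ p.2 ∈ F ∧
      ∀ x ∈ E, ∀ y ∈ F, f (x, y) = f p := by
  obtain ⟨E, F, hE, hF, h1, h2, h⟩ :=
    exists_rectangle_of_measurableSet (hf (measurableSet_singleton (f p))) p
  exact ⟨E, F, hE, hF, h1, h2, fun x hx y hy => (h x hx y hy).2 rfl⟩

namespace LInfty

variable {X Y Z : Type u} [MeasurableSpace X] [MeasurableSpace Y] [MeasurableSpace Z]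

/-- Composition with a measurable map. -/
noncomputable def comap (p : X → Y) (hp : Measurable p) : LInfty Y →⋆ₐ[ℂ] LInfty X where
  toFun f := mk (fun x => f (p x)) (f.measurable.comp hp) ‖f‖ fun x => f.norm_apply_le (p x)
  map_one' := rfl
  map_mul' _ _ := rfl
  map_zero' := rfl
  map_add' _ _ := rfl
  commutes' _ := rfl
  map_star' _ := rfl

/-- The function `(x, y) ↦ f x * g y`. -/
noncomputable def prodMul (f : LInfty X) (g : LInfty Y) : LInfty (X × Y) :=
  comap Prod.fst measurable_fst f * comap Prod.snd measurable_snd g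

@[simp] lemma prodMul_apply (f : LInfty X) (g : LInfty Y) (p : X × Y) :
    prodMul f g p = f p.1 * g p.2 := rfl

lemma prodMul_ind {E : Set X} {F : Set Y} (hE : MeasurableSet E) (hF : MeasurableSet F) :
    prodMul (ind hE) (ind hF) = ind (hE.prod hF) := by
  ext p
  simp only [prodMul_apply, ind_apply]
  by_cases h1 : p.1 ∈ E <;> by_cases h2 : p.2 ∈ F <;> simp [Set.indicator, Set.mem_prod, h1, h2]

/-- Products of indicators are indicators of measurable rectangles, a `π`-system generating the
product `σ`-algebra. -/
lemma eq_top_of_prodMul_mem {V : Submodule ℂ (LInfty (X × Y))} (hV : IsSigmaClosed V)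
    (h : ∀ f g, prodMul f g ∈ V) : V = ⊤ := by
  refine eq_top_of_isPiSystem hV generateFrom_prod.symm isPiSystem_prod ?_ fun R hR hmem => ?_
  · have : prodMul (1 : LInfty X) (1 : LInfty Y) = 1 := by ext; simp
    exact this ▸ h 1 1
  · obtain ⟨E, hE, F, hF, rfl⟩ := hmem
    rw [← prodMul_ind hE hF]
    exact h _ _

end LInfty

/-! ### The C⋆-tensor product of commutative C⋆-algebras -/

section CStarTensor

variable (A B : Type u) [CommCStarAlgebra A] [CommCStarAlgebra B]

/-- The C⋆-tensor product of two commutative C⋆-algebras. -/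
abbrev CStarTensor : Type u := C(WeakDual.characterSpace ℂ A × WeakDual.characterSpace ℂ B, ℂ)

namespace CStarTensor

/-- The homomorphism `a ↦ a ⊗ 1`. -/
noncomputable def inl : A →⋆ₐ[ℂ] CStarTensor A B :=
  (ContinuousMap.compStarAlgHom' ℂ ℂ ⟨Prod.fst, continuous_fst⟩).comp
    (gelfandStarTransform A : A →⋆ₐ[ℂ] C(WeakDual.characterSpace ℂ A, ℂ))

/-- The homomorphism `b ↦ 1 ⊗ b`. -/
noncomputable def inr : B →⋆ₐ[ℂ] CStarTensor A B :=
  (ContinuousMap.compStarAlgHom' ℂ ℂ ⟨Prod.snd, continuous_snd⟩).comp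
    (gelfandStarTransform B : B →⋆ₐ[ℂ] C(WeakDual.characterSpace ℂ B, ℂ))

variable {A B}

/-- The C⋆-tensor product is generated by the images of its factors. -/
lemma eq_top {S : StarSubalgebra ℂ (CStarTensor A B)} (hS : IsClosed (S : Set (CStarTensor A B)))
    (hl : ∀ a, inl A B a ∈ S) (hr : ∀ b, inr A B b ∈ S) : S = ⊤ := by
  -- Stone–Weierstrass: two pairs of characters that agree on both factors are equal.
  rw [← ContinuousMap.starSubalgebra_topologicalClosure_eq_top_of_separatesPoints S ?_]
  · exact le_antisymm S.le_topologicalClosure (StarSubalgebra.topologicalClosure_minimal le_rfl hS)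
  · intro p q hpq
    by_contra! h
    refine hpq (Prod.ext ?_ ?_)
    · exact WeakDual.CharacterSpace.ext fun a => h _ ⟨inl A B a, hl a, rfl⟩
    · exact WeakDual.CharacterSpace.ext fun b => h _ ⟨inr A B b, hr b, rfl⟩

lemma starAlgHom_ext {D : Type u} [CommCStarAlgebra D] {h k : CStarTensor A B →⋆ₐ[ℂ] D}
    (hl : h.comp (inl A B) = k.comp (inl A B)) (hr : h.comp (inr A B) = k.comp (inr A B)) :
    h = k := by
  have : StarAlgHom.equalizer h k = ⊤ := eq_top
    (isClosed_eq (map_continuous h) (map_continuous k))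
    (fun a => DFunLike.congr_fun hl a) (fun b => DFunLike.congr_fun hr b)
  ext t
  exact (this ▸ StarSubalgebra.mem_top : t ∈ StarAlgHom.equalizer h k)

/-- By Gelfand duality, a pair of homomorphisms into `D` is a continuous map from the characters of
`D` to the product of character spaces; pulling back along it gives the required homomorphism. -/
lemma isCStarTensorProduct : IsCStarTensorProduct (inl A B) (inr A B) := by
  intro D _ f g
  have hl : (((gelfandStarTransform D).symm : C(WeakDual.characterSpace ℂ D, ℂ) →⋆ₐ[ℂ] D).comp
      (ContinuousMap.compStarAlgHom' ℂ ℂ ((WeakDual.CharacterSpace.compContinuousMap f).prodMk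
        (WeakDual.CharacterSpace.compContinuousMap g)))).comp (inl A B) = f := by
    ext a
    exact (gelfandStarTransform D).symm_apply_apply (f a)
  have hr : (((gelfandStarTransform D).symm : C(WeakDual.characterSpace ℂ D, ℂ) →⋆ₐ[ℂ] D).comp
      (ContinuousMap.compStarAlgHom' ℂ ℂ ((WeakDual.CharacterSpace.compContinuousMap f).prodMk
        (WeakDual.CharacterSpace.compContinuousMap g)))).comp (inr A B) = g := by
    ext b
    exact (gelfandStarTransform D).symm_apply_apply (g b)
  exact ⟨_, ⟨hl, hr⟩, fun k hk => starAlgHom_ext (hk.1.trans hl.symm) (hk.2.trans hr.symm)⟩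

end CStarTensor

end CStarTensor

/-! ### The regular tensor product -/

namespace SigmaSpec

variable {A : Type u} [CommCStarAlgebra A] [PartialOrder A]

/-- A point of the `σ`-spectrum as a character. -/
noncomputable def toCharacter (φ : SigmaSpec A) : WeakDual.characterSpace ℂ A :=
  WeakDual.CharacterSpace.equivAlgHom.symm (φ.1 : A →ₐ[ℂ] ℂ)

@[simp] lemma toCharacter_apply (φ : SigmaSpec A) (a : A) : φ.toCharacter a = φ a := rfl

end SigmaSpec

namespace CPureRep

variable {A B : CPureRep.{u}}

/-- The `σ`-spectrum is dense in the space of characters. -/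
lemma denseRange_toCharacter : DenseRange (SigmaSpec.toCharacter (A := A)) := by
  intro χ
  by_contra hχ
  -- A Urysohn function vanishing on the closure but not at `χ` would be a nonzero element killed by
  -- every point of the `σ`-spectrum.
  obtain ⟨f, hf0, hf1, -⟩ := exists_continuous_zero_one_of_isClosed
    (isClosed_closure (s := Set.range (SigmaSpec.toCharacter (A := A))))
    (isClosed_singleton (x := χ)) (Set.disjoint_singleton_right.2 hχ)
  let F : C(WeakDual.characterSpace ℂ A, ℂ) := ⟨fun χ => f χ, by fun_prop⟩
  have hF : ∀ χ : WeakDual.characterSpace ℂ A, χ ((gelfandStarTransform A).symm F) = f χ :=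
    fun χ => congrArg (fun G : C(WeakDual.characterSpace ℂ A, ℂ) => G χ)
      ((gelfandStarTransform A).apply_symm_apply F)
  have h0 : (gelfandStarTransform A).symm F = 0 := eq_zero_of_forall_spec fun φ => by
    rw [← SigmaSpec.toCharacter_apply, hF, hf0 (subset_closure ⟨φ, rfl⟩)]
    simp
  have h1 := hF χ
  rw [h0, map_zero, hf1 rfl] at h1
  simp at h1

variable (A B)

/-- The regular tensor product of two commutative purely `σ`-representable `σC⋆`-algebras. -/
noncomputable def tens : CPureRep.{u} := linftyObj (SigmaSpec A × SigmaSpec B)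

/-- The homomorphism `a ↦ a ⊗ 1`. -/
noncomputable def inl : A →⋆ₐ[ℂ] tens A B :=
  (LInfty.comap Prod.fst measurable_fst).comp (gelfand A)

/-- The homomorphism `b ↦ 1 ⊗ b`. -/
noncomputable def inr : B →⋆ₐ[ℂ] tens A B :=
  (LInfty.comap Prod.snd measurable_snd).comp (gelfand B)

/-- The map on pairs of characters induced by the inclusion of the `σ`-spectra. -/
noncomputable def toCharacters (p : SigmaSpec A × SigmaSpec B) :
    WeakDual.characterSpace ℂ A × WeakDual.characterSpace ℂ B :=
  (p.1.toCharacter, p.2.toCharacter)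

lemma denseRange_toCharacters : DenseRange (toCharacters A B) :=
  denseRange_toCharacter.prodMap denseRange_toCharacter

/-- Continuity alone does not suffice, as the spectra carry only the `σ`-algebras generated by
evaluations. The functions with measurable pullback form a closed star subalgebra containing both
factors. -/
lemma measurable_comp_toCharacters (F : CStarTensor A B) :
    Measurable fun p => F (toCharacters A B p) := by
  let S : StarSubalgebra ℂ (CStarTensor A B) :=
    { carrier := {F | Measurable fun p => F (toCharacters A B p)}
      mul_mem' := fun hf hg => hf.mul hg
      add_mem' := fun hf hg => hf.add hg
      algebraMap_mem' := fun c => measurable_const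
      star_mem' := fun hf => Complex.continuous_conj.measurable.comp hf }
  have hS : IsClosed (S : Set (CStarTensor A B)) := by
    refine IsSeqClosed.isClosed fun a f ha hf => ?_
    refine measurable_of_tendsto_metrizable (f := fun n p => a n (toCharacters A B p)) ha ?_
    rw [tendsto_pi_nhds]
    intro p
    exact ((continuous_eval_const (toCharacters A B p)).tendsto f).comp hf
  have : S = ⊤ := CStarTensor.eq_top hS
    (fun a => (SigmaSpec.measurable_apply a).comp measurable_fst)
    (fun b => (SigmaSpec.measurable_apply b).comp measurable_snd)
  exact (this ▸ StarSubalgebra.mem_top : F ∈ S)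

/-- The inclusion of the C⋆-tensor product into the regular tensor product. -/
noncomputable def ofCStarTensor : CStarTensor A B →⋆ₐ[ℂ] LInfty (SigmaSpec A × SigmaSpec B) where
  toFun F := LInfty.mk (fun p => F (toCharacters A B p)) (measurable_comp_toCharacters A B F) ‖F‖
    fun _ => F.norm_coe_le_norm _
  map_one' := rfl
  map_mul' _ _ := rfl
  map_zero' := rfl
  map_add' _ _ := rfl
  commutes' _ := rfl
  map_star' _ := rfl

variable {A B}

/-- An inequality between continuous functions is a closed condition, and pairs of points are dense
among pairs of characters. -/
lemma ofCStarTensor_le_iff {F G : CStarTensor A B} :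
    ofCStarTensor A B F ≤ ofCStarTensor A B G ↔ F ≤ G := by
  refine ⟨fun h => ?_, fun h p => h (toCharacters A B p)⟩
  intro q
  refine (denseRange_toCharacters A B).induction_on (p := fun q => F q ≤ G q) q ?_ h
  exact isClosed_le F.continuous G.continuous

lemma ofCStarTensor_injective : Function.Injective (ofCStarTensor A B) := fun _ _ h =>
  le_antisymm (ofCStarTensor_le_iff.1 h.le) (ofCStarTensor_le_iff.1 h.ge)

/-- The indicator functions of measurable rectangles belong to the C⋆-tensor product. -/
lemma exists_ofCStarTensor_eq_ind {E : Set (SigmaSpec A)} {F : Set (SigmaSpec B)}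
    (hE : MeasurableSet E) (hF : MeasurableSet F) :
    ∃ t : CStarTensor A B, ofCStarTensor A B t = LInfty.ind (hE.prod hF) := by
  refine ⟨CStarTensor.inl A B (gelfandInv A (LInfty.ind hE)) *
    CStarTensor.inr A B (gelfandInv B (LInfty.ind hF)), ?_⟩
  rw [← LInfty.prodMul_ind]
  ext p
  rw [LInfty.prodMul_apply, ← apply_gelfandInv, ← apply_gelfandInv]
  rfl

/-- If an upper bound `b` failed to dominate `s` at `p`, then `s` could be lowered to the value `b
p` on a rectangle around `p` where both are constant. The result is still an upper bound and still
in the C⋆-tensor product, contradicting leastness of `s`. -/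
lemma ofCStarTensor_sigmaNormal : SigmaNormal (ofCStarTensor A B) := by
  intro a s ha hs
  refine ⟨?_, fun b hb p => ?_⟩
  · rintro _ ⟨n, rfl⟩
    exact ofCStarTensor_le_iff.2 (hs.1 ⟨n, rfl⟩)
  by_contra hlt
  obtain ⟨E, F, hE, hF, h1, h2, h⟩ := exists_rectangle_eq
    (f := fun q => (ofCStarTensor A B s q, b q))
    ((ofCStarTensor A B s).measurable.prodMk b.measurable) p
  obtain ⟨t, ht⟩ := exists_ofCStarTensor_eq_ind hE hF
  have hp : LInfty.ind (hE.prod hF) p = 1 := by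
    rw [LInfty.ind_apply, Set.indicator_of_mem (s := E ×ˢ F) (a := p) ⟨h1, h2⟩]
  have hub : ∀ n, a n ≤ s - (ofCStarTensor A B s p - b p) • t := by
    intro n
    rw [← ofCStarTensor_le_iff, map_sub, map_smul, ht]
    intro q
    rw [LInfty.sub_apply, LInfty.smul_apply, LInfty.ind_apply]
    by_cases hq : q ∈ E ×ˢ F
    · rw [Set.indicator_of_mem hq]
      have h3 := Prod.ext_iff.1 (h q.1 hq.1 q.2 hq.2)
      have h4 : ofCStarTensor A B s q = ofCStarTensor A B s p := h3.1
      have h5 : b q = b p := h3.2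
      rw [h4, mul_one, sub_sub_cancel, ← h5]
      exact hb ⟨n, rfl⟩ q
    · rw [Set.indicator_of_notMem hq, mul_zero, sub_zero]
      exact ofCStarTensor_le_iff.2 (hs.1 ⟨n, rfl⟩) q
  have hle : s ≤ s - (ofCStarTensor A B s p - b p) • t := hs.2 (by rintro _ ⟨n, rfl⟩; exact hub n)
  have h6 := ofCStarTensor_le_iff.2 hle p
  rw [map_sub, map_smul, ht, LInfty.sub_apply, LInfty.smul_apply, hp, mul_one, sub_sub_cancel] at h6
  exact hlt h6

lemma isRegularSigmaCompletion_ofCStarTensor : IsRegularSigmaCompletion (ofCStarTensor A B) where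
  isSigmaComplete := LInfty.isSigmaComplete
  injective := ofCStarTensor_injective
  sigmaNormal := ofCStarTensor_sigmaNormal
  generates V _ hsup hmem := LInfty.eq_top_of_prodMul_mem hsup fun f g => by
    have : LInfty.prodMul f g = ofCStarTensor A B (CStarTensor.inl A B (gelfandInv A f) *
        CStarTensor.inr A B (gelfandInv B g)) := by
      ext p
      rw [LInfty.prodMul_apply, ← apply_gelfandInv, ← apply_gelfandInv]
      rfl
    exact this ▸ hmem _
  isLUB b hb := by
    refine ⟨fun c hc => hc.1, fun v hv p => ?_⟩
    obtain ⟨E, F, hE, hF, h1, h2, h⟩ := exists_rectangle_eq (f := b) b.measurable p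
    obtain ⟨t, ht⟩ := exists_ofCStarTensor_eq_ind hE hF
    have hp : LInfty.ind (hE.prod hF) p = 1 := by
      rw [LInfty.ind_apply, Set.indicator_of_mem (s := E ×ˢ F) (a := p) ⟨h1, h2⟩]
    -- This element equals `b p` on the rectangle and `-‖b‖` off it: it lies below `b` and attains
    -- its value at `p`.
    have hval : ∀ q, ofCStarTensor A B (algebraMap ℂ _ (-‖b‖ : ℂ) + (b p + ‖b‖) • t) q =
        -‖b‖ + (b p + ‖b‖) * LInfty.ind (hE.prod hF) q := fun q => by
      rw [map_add, map_smul, ht]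
      rfl
    have hle : ofCStarTensor A B (algebraMap ℂ _ (-‖b‖ : ℂ) + (b p + ‖b‖) • t) ≤ b := by
      intro q
      rw [hval, LInfty.ind_apply]
      by_cases hq : q ∈ E ×ˢ F
      · rw [Set.indicator_of_mem hq, mul_one, neg_add_cancel_comm_assoc]
        exact (h q.1 hq.1 q.2 hq.2).ge
      · rw [Set.indicator_of_notMem hq, mul_zero, add_zero, ← LInfty.isSelfAdjoint_iff.1 hb q]
        have := (abs_le.1 ((Complex.abs_re_le_norm _).trans (b.norm_apply_le q))).1
        exact_mod_cast this
    have h3 := hv ⟨hle, _, rfl⟩ p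
    rwa [hval, hp, mul_one, neg_add_cancel_comm_assoc] at h3

lemma isRegularTensorProduct : IsRegularTensorProduct (inl A B) (inr A B) :=
  ⟨CStarTensor A B, inferInstance, inferInstance, inferInstance, CStarTensor.inl A B,
    CStarTensor.inr A B, ofCStarTensor A B, CStarTensor.isCStarTensorProduct,
    isRegularSigmaCompletion_ofCStarTensor, rfl, rfl⟩

end CPureRep

namespace CPureRep

variable {A B C D E : CPureRep.{u}}

/-! ### Sequential `σ`-continuity -/

/-- Bounded pointwise convergence on the `σ`-spectrum. -/
def SigmaTendsto (a : ℕ → A) (s : A) : Prop :=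
  (∃ r : ℝ, ∀ n, ‖a n‖ ≤ r) ∧
    ∀ φ : SigmaSpec A, Filter.Tendsto (fun n => φ (a n)) Filter.atTop (nhds (φ s))

/-- Sequential continuity for bounded pointwise convergence. -/
def SigmaContinuous (L : A →ₗ[ℂ] B) : Prop :=
  ∀ (a : ℕ → A) (s : A), SigmaTendsto a s → SigmaTendsto (fun n => L (a n)) (L s)

lemma sigmaTendsto_of_isLUB {a : ℕ → A} {s : A} (ha : IsBddMonoSeq a)
    (hs : IsLUB (Set.range a) s) : SigmaTendsto a s :=
  ⟨ha.bounded, fun φ => φ.tendsto_of_isLUB ha hs⟩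

lemma SigmaTendsto.unique {a : ℕ → A} {s t : A} (hs : SigmaTendsto a s) (ht : SigmaTendsto a t) :
    s = t :=
  ext_spec fun φ => tendsto_nhds_unique (hs.2 φ) (ht.2 φ)

lemma SigmaContinuous.comp {L : A →ₗ[ℂ] B} {M : B →ₗ[ℂ] C} (hM : SigmaContinuous M)
    (hL : SigmaContinuous L) : SigmaContinuous (M ∘ₗ L) :=
  fun a s h => hM _ _ (hL a s h)

/-- The linear map underlying a morphism. -/
noncomputable def toLin (f : A ⟶ B) : A →ₗ[ℂ] B := CompletelyPositiveMap.toLinearMap f.1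

@[simp] lemma toLin_apply (f : A ⟶ B) (a : A) : toLin f a = f a := rfl

/-- Each `ψ ∘ f` is integration against a probability measure on the spectrum of `A`, so dominated
convergence covers all bounded pointwise convergent sequences, monotone or not. -/
lemma sigmaContinuous_toLin (f : A ⟶ B) : SigmaContinuous (toLin f) := by
  rintro a s ⟨⟨r, hr⟩, h⟩
  obtain ⟨c, hc⟩ := (SigmaCPU.toPositive (A := A) (B := B) f).exists_norm_apply_le
  refine ⟨⟨c * r, fun n => (hc (a n)).trans (mul_le_mul_of_nonneg_left (hr n) c.2)⟩, fun ψ => ?_⟩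
  let μ : Measure (SigmaSpec A) := (specMap f).hom.hom ψ
  have hμ : ∀ b : A, ∫ φ : SigmaSpec A, φ b ∂μ = ψ (f b) := sigmaSpecAction.integral_map f ψ
  have : IsProbabilityMeasure μ := (specMap f).2.isProbabilityMeasure ψ
  simp only [toLin_apply]
  rw [← hμ]
  simp_rw [← hμ]
  exact tendsto_integral_of_dominated_convergence (fun _ => r)
    (fun n => (SigmaSpec.measurable_apply (a n)).aestronglyMeasurable) (integrable_const r)
    (fun n => Filter.Eventually.of_forall fun φ => (φ.norm_apply_le _).trans (hr n))
    (Filter.Eventually.of_forall h)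

/-- Multiplication by an arbitrary element need not preserve monotone sequences. Bounded pointwise
convergence survives it, which allows one tensor factor to be fixed at a time. -/
lemma sigmaContinuous_mulLeft (c : A) : SigmaContinuous (LinearMap.mulLeft ℂ c) := by
  rintro a s ⟨⟨r, hr⟩, h⟩
  refine ⟨⟨‖c‖ * r, fun n => (norm_mul_le _ _).trans
    (mul_le_mul_of_nonneg_left (hr n) (norm_nonneg c))⟩, fun φ => ?_⟩
  simp only [LinearMap.mulLeft_apply, map_mul]
  exact (h φ).const_mul _

lemma sigmaContinuous_mulRight (c : A) : SigmaContinuous (LinearMap.mulRight ℂ c) := by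
  have : LinearMap.mulRight ℂ c = LinearMap.mulLeft ℂ c := by
    ext a
    simp [mul_comm]
  exact this ▸ sigmaContinuous_mulLeft c

/-! ### Elementary tensors -/

lemma inl_sigmaNormal : SigmaNormal (inl A B) := fun _ _ ha hs =>
  LInfty.isLUB_of_tendsto (fun _ _ h p => p.1.monotone (ha.monotone h)) fun p =>
    p.1.tendsto_of_isLUB ha hs

lemma inr_sigmaNormal : SigmaNormal (inr A B) := fun _ _ ha hs =>
  LInfty.isLUB_of_tendsto (fun _ _ h p => p.2.monotone (ha.monotone h)) fun p =>
    p.2.tendsto_of_isLUB ha hs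

/-- The morphism `a ↦ a ⊗ 1`. -/
noncomputable def inlHom (A B : CPureRep.{u}) : A ⟶ tens A B :=
  SigmaCPU.ofStarAlgHom (inl A B) inl_sigmaNormal

/-- The morphism `b ↦ 1 ⊗ b`. -/
noncomputable def inrHom (A B : CPureRep.{u}) : B ⟶ tens A B :=
  SigmaCPU.ofStarAlgHom (inr A B) inr_sigmaNormal

@[simp] lemma inlHom_apply (a : A) : inlHom A B a = inl A B a := rfl

@[simp] lemma inrHom_apply (b : B) : inrHom A B b = inr A B b := rfl

/-- The elementary tensor `a ⊗ b`. -/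
noncomputable def tmul (a : A) (b : B) : tens A B := inl A B a * inr A B b

lemma tmul_def (a : A) (b : B) : tmul a b = inl A B a * inr A B b := rfl

/-- The linear map `a ↦ a ⊗ b`. -/
noncomputable def tmulRight (A : CPureRep.{u}) (b : B) : A →ₗ[ℂ] tens A B :=
  LinearMap.mulRight ℂ (inr A B b) ∘ₗ toLin (inlHom A B)

/-- The linear map `b ↦ a ⊗ b`. -/
noncomputable def tmulLeft (a : A) (B : CPureRep.{u}) : B →ₗ[ℂ] tens A B :=
  LinearMap.mulLeft ℂ (inl A B a) ∘ₗ toLin (inrHom A B)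

lemma sigmaContinuous_tmulRight (b : B) : SigmaContinuous (tmulRight A b) :=
  (sigmaContinuous_mulRight _).comp (sigmaContinuous_toLin _)

lemma sigmaContinuous_tmulLeft (a : A) : SigmaContinuous (tmulLeft a B) :=
  (sigmaContinuous_mulLeft _).comp (sigmaContinuous_toLin _)

lemma smul_tmul (c : ℂ) (a : A) (b : B) : tmul (c • a) b = c • tmul a b :=
  map_smul (tmulRight A b) c a

lemma tmul_smul (c : ℂ) (a : A) (b : B) : tmul a (c • b) = c • tmul a b :=
  map_smul (tmulLeft a B) c b

lemma tmul_mul_tmul (a a' : A) (b b' : B) :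
    tmul a b * tmul a' b' = tmul (a * a') (b * b') := by
  simp only [tmul_def, map_mul]
  exact mul_mul_mul_comm _ _ _ _

lemma inl_eq_tmul (a : A) : inl A B a = tmul a 1 := by rw [tmul_def, map_one, mul_one]

lemma inr_eq_tmul (b : B) : inr A B b = tmul 1 b := by rw [tmul_def, map_one, one_mul]

/-- `σ`-continuous linear maps are determined by their values on products of functions. -/
lemma SigmaContinuous.ext_prodMul {X Y : Type u} [MeasurableSpace X] [MeasurableSpace Y]
    {L M : linftyObj (X × Y) →ₗ[ℂ] C} (hL : SigmaContinuous L) (hM : SigmaContinuous M)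
    (h : ∀ (f : LInfty X) (g : LInfty Y), L (LInfty.prodMul f g) = M (LInfty.prodMul f g)) :
    L = M := by
  refine LinearMap.eqLocus_eq_top.1 (LInfty.eq_top_of_prodMul_mem
    (V := LinearMap.eqLocus L M) (fun b s hb hmem hs => ?_) h)
  have hlim : SigmaTendsto (A := linftyObj (X × Y)) b s := sigmaTendsto_of_isLUB hb hs
  refine (hL b s hlim).unique ?_
  have h2 : (fun n => L (b n)) = fun n => M (b n) := funext hmem
  rw [h2]
  exact hM b s hlim

/-- `σ`-continuous linear maps are determined by their values on elementary tensors. -/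
lemma SigmaContinuous.ext {L M : tens A B →ₗ[ℂ] C} (hL : SigmaContinuous L)
    (hM : SigmaContinuous M) (h : ∀ a b, L (tmul a b) = M (tmul a b)) : L = M := by
  refine SigmaContinuous.ext_prodMul (X := SigmaSpec A) (Y := SigmaSpec B) hL hM fun f g => ?_
  have : LInfty.prodMul f g = tmul (gelfandInv A f) (gelfandInv B g) :=
    LInfty.ext (X := SigmaSpec A × SigmaSpec B) fun p => by
      rw [LInfty.prodMul_apply, ← apply_gelfandInv, ← apply_gelfandInv]
      rfl
  rw [this]
  exact h _ _

lemma hom_ext_tmul {f g : tens A B ⟶ C} (h : ∀ a b, f (tmul a b) = g (tmul a b)) : f = g :=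
  hom_ext fun t => LinearMap.congr_fun
    ((sigmaContinuous_toLin f).ext (sigmaContinuous_toLin g) h) t

/-- With `c` fixed, `t ↦ f (t ⊗ c)` is in general not a morphism, but it is linear and
`σ`-continuous, so the extensionality principle applies again to `t`. -/
lemma hom_ext_tmul_left {f g : tens (tens A B) C ⟶ D}
    (h : ∀ a b c, f (tmul (tmul a b) c) = g (tmul (tmul a b) c)) : f = g :=
  hom_ext_tmul fun t c => LinearMap.congr_fun (SigmaContinuous.ext
    ((sigmaContinuous_toLin f).comp (sigmaContinuous_tmulRight c))
    ((sigmaContinuous_toLin g).comp (sigmaContinuous_tmulRight c)) fun a b => h a b c) t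

lemma hom_ext_tmul_right {f g : tens A (tens B C) ⟶ D}
    (h : ∀ a b c, f (tmul a (tmul b c)) = g (tmul a (tmul b c))) : f = g :=
  hom_ext_tmul fun a t => LinearMap.congr_fun (SigmaContinuous.ext
    ((sigmaContinuous_toLin f).comp (sigmaContinuous_tmulLeft a))
    ((sigmaContinuous_toLin g).comp (sigmaContinuous_tmulLeft a)) fun b c => h a b c) t

lemma hom_ext_tmul_left_left {f g : tens (tens (tens A B) C) D ⟶ E}
    (h : ∀ a b c d, f (tmul (tmul (tmul a b) c) d) = g (tmul (tmul (tmul a b) c) d)) : f = g :=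
  hom_ext_tmul_left fun t c d => LinearMap.congr_fun (SigmaContinuous.ext
    (((sigmaContinuous_toLin f).comp (sigmaContinuous_tmulRight d)).comp
      (sigmaContinuous_tmulRight c))
    (((sigmaContinuous_toLin g).comp (sigmaContinuous_tmulRight d)).comp
      (sigmaContinuous_tmulRight c)) fun a b => h a b c d) t

lemma hom_ext_tmul_tmul {f g : tens (tens A B) (tens C D) ⟶ E}
    (h : ∀ a b c d, f (tmul (tmul a b) (tmul c d)) = g (tmul (tmul a b) (tmul c d))) : f = g :=
  hom_ext_tmul_left fun a b t => LinearMap.congr_fun (SigmaContinuous.ext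
    ((sigmaContinuous_toLin f).comp (sigmaContinuous_tmulLeft (tmul a b)))
    ((sigmaContinuous_toLin g).comp (sigmaContinuous_tmulLeft (tmul a b))) fun c d => h a b c d) t

/-! ### Morphisms out of tensor products -/

/-- The Markov kernel on the `σ`-spectrum associated to a morphism out of `𝓛^∞(X)`. -/
noncomputable def homKernel {X : Type u} [MeasurableSpace X] (p : linftyObj X ⟶ C) :
    Kernel (SigmaSpec C) X :=
  SigmaSpec.kernel (A := C) p

instance {X : Type u} [MeasurableSpace X] (p : linftyObj X ⟶ C) : IsMarkovKernel (homKernel p) :=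
  SigmaSpec.instIsMarkovKernelKernel (A := C) p

lemma integral_homKernel {X : Type u} [MeasurableSpace X] (p : linftyObj X ⟶ C) (ψ : SigmaSpec C)
    (f : LInfty X) : ∫ x, f x ∂(homKernel p ψ) = ψ (p f) :=
  SigmaSpec.integral_kernel (A := C) p ψ f

/-- The morphism `f ⊗ g ↦ p f * q g` on bounded measurable functions. -/
noncomputable def prodLift {X Y : Type u} [MeasurableSpace X] [MeasurableSpace Y]
    (p : linftyObj X ⟶ C) (q : linftyObj Y ⟶ C) : linftyObj (X × Y) ⟶ C :=
  SigmaCPU.comp (A := LInfty (X × Y)) (C := C) (gelfandInv C)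
    (LInfty.koopman (homKernel p ×ₖ homKernel q))

/-- At each point `ψ` the integral is against the product of the measures representing `ψ ∘ p` and
`ψ ∘ q`. It factors by Fubini, and `ψ` is multiplicative. -/
lemma prodLift_prodMul {X Y : Type u} [MeasurableSpace X] [MeasurableSpace Y]
    (p : linftyObj X ⟶ C) (q : linftyObj Y ⟶ C) (f : LInfty X) (g : LInfty Y) :
    prodLift p q (LInfty.prodMul f g) = p f * q g := by
  refine ext_spec fun ψ => ?_
  refine (apply_gelfandInv _ ψ).trans ?_
  refine (LInfty.koopman_apply (homKernel p ×ₖ homKernel q) (LInfty.prodMul f g) ψ).trans ?_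
  simp only [LInfty.prodMul_apply]
  rw [Kernel.prod_apply, map_mul]
  refine (integral_prod_mul (fun x => f x) (fun y => g y)).trans ?_
  exact congrArg₂ _ (integral_homKernel p ψ f) (integral_homKernel q ψ g)

/-- The morphism `a ⊗ b ↦ f a * g b`. -/
noncomputable def lift (f : A ⟶ C) (g : B ⟶ C) : tens A B ⟶ C :=
  prodLift ((gelfandIso A).inv ≫ f) ((gelfandIso B).inv ≫ g)

@[simp] lemma lift_tmul (f : A ⟶ C) (g : B ⟶ C) (a : A) (b : B) :
    lift f g (tmul a b) = f a * g b := by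
  refine (prodLift_prodMul _ _ (gelfandHom A a) (gelfandHom B b)).trans ?_
  change f (gelfandInv A (gelfandHom A a)) * g (gelfandInv B (gelfandHom B b)) = _
  rw [gelfandInv_gelfandHom, gelfandInv_gelfandHom]

end CPureRep

namespace CPureRep

variable {A A' B B' C D : CPureRep.{u}}

@[simp] lemma hom_map_one (f : A ⟶ B) : f 1 = 1 := SigmaCPU.map_one (A := A) (B := B) f

/-! ### The unit object -/

/-- The unit object `ℂ`. -/
noncomputable def unitObj : CPureRep.{u} := linftyObj PUnit.{u + 1}

/-- The canonical isomorphism of the unit object with `ℂ`. -/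
noncomputable def ofUnit : unitObj.{u} →⋆ₐ[ℂ] ℂ := LInfty.eval PUnit.unit

lemma algebraMap_ofUnit (z : unitObj.{u}) : algebraMap ℂ unitObj.{u} (ofUnit z) = z :=
  LInfty.ext (X := PUnit.{u + 1}) fun _ => rfl

@[simp] lemma ofUnit_algebraMap (z : ℂ) : ofUnit.{u} (algebraMap ℂ unitObj.{u} z) = z :=
  AlgHomClass.commutes ofUnit.{u} z

lemma bijective_algebraMap_unitObj : Function.Bijective (algebraMap ℂ unitObj.{u}) :=
  ⟨Function.LeftInverse.injective ofUnit_algebraMap, fun z => ⟨ofUnit z, algebraMap_ofUnit z⟩⟩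

/-- The unit `ℂ → A` of the algebra. -/
noncomputable def unitHom (A : CPureRep.{u}) : unitObj.{u} ⟶ A :=
  SigmaCPU.ofStarAlgHom ((StarAlgHom.ofId ℂ A).comp ofUnit) fun a s ha hs => by
    have hφ : ∀ (φ : SigmaSpec A) (z : unitObj.{u}),
        φ ((StarAlgHom.ofId ℂ A).comp ofUnit z) = ofUnit z :=
      fun φ z => AlgHomClass.commutes φ _
    refine isLUB_of_tendsto (fun m n h => le_iff.2 fun φ => ?_) fun φ => ?_
    · rw [hφ, hφ]
      exact ha.monotone h PUnit.unit
    · simp only [hφ]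
      exact LInfty.tendsto_of_isLUB (X := PUnit.{u + 1}) ha hs PUnit.unit

lemma unitHom_apply (z : unitObj.{u}) : unitHom A z = algebraMap ℂ A (ofUnit z) := rfl

lemma tmul_unit_left (z : unitObj.{u}) (a : A) : tmul z a = ofUnit z • inr unitObj A a := by
  rw [inr_eq_tmul, ← smul_tmul, ← Algebra.algebraMap_eq_smul_one, algebraMap_ofUnit]

lemma tmul_unit_right (z : unitObj.{u}) (a : A) : tmul a z = ofUnit z • inl A unitObj a := by
  rw [inl_eq_tmul, ← tmul_smul, ← Algebra.algebraMap_eq_smul_one, algebraMap_ofUnit]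

/-! ### Structure morphisms -/

/-- The tensor product of morphisms. -/
noncomputable def tensHom (f : A ⟶ A') (g : B ⟶ B') : tens A B ⟶ tens A' B' :=
  lift (f ≫ inlHom A' B') (g ≫ inrHom A' B')

@[simp] lemma tensHom_tmul (f : A ⟶ A') (g : B ⟶ B') (a : A) (b : B) :
    tensHom f g (tmul a b) = tmul (f a) (g b) := lift_tmul _ _ a b

@[simp] lemma tensHom_inr (f : A ⟶ A') (g : B ⟶ B') (b : B) :
    tensHom f g (inr A B b) = inr A' B' (g b) := by
  rw [inr_eq_tmul, tensHom_tmul, hom_map_one, inr_eq_tmul]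

/-- The map `(a ⊗ b) ⊗ c ↦ a ⊗ (b ⊗ c)`. -/
noncomputable def assocHom (A B C : CPureRep.{u}) : tens (tens A B) C ⟶ tens A (tens B C) :=
  lift (lift (inlHom A (tens B C)) (inlHom B C ≫ inrHom A (tens B C)))
    (inrHom B C ≫ inrHom A (tens B C))

@[simp] lemma assocHom_tmul (a : A) (b : B) (c : C) :
    assocHom A B C (tmul (tmul a b) c) = tmul a (tmul b c) := by
  rw [assocHom, lift_tmul, lift_tmul]
  simp only [CategoryTheory.comp_apply, inlHom_apply, inrHom_apply, tmul_def, map_mul, mul_assoc]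

/-- The map `a ⊗ (b ⊗ c) ↦ (a ⊗ b) ⊗ c`. -/
noncomputable def assocInv (A B C : CPureRep.{u}) : tens A (tens B C) ⟶ tens (tens A B) C :=
  lift (inlHom A B ≫ inlHom (tens A B) C)
    (lift (inrHom A B ≫ inlHom (tens A B) C) (inrHom (tens A B) C))

@[simp] lemma assocInv_tmul (a : A) (b : B) (c : C) :
    assocInv A B C (tmul a (tmul b c)) = tmul (tmul a b) c := by
  rw [assocInv, lift_tmul, lift_tmul]
  simp only [CategoryTheory.comp_apply, inlHom_apply, inrHom_apply, tmul_def, map_mul, mul_assoc]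

/-- The map `z ⊗ a ↦ z • a`. -/
noncomputable def leftHom (A : CPureRep.{u}) : tens unitObj A ⟶ A := lift (unitHom A) (𝟙 A)

@[simp] lemma leftHom_tmul (z : unitObj.{u}) (a : A) : leftHom A (tmul z a) = ofUnit z • a := by
  rw [leftHom, lift_tmul, unitHom_apply, Algebra.smul_def]
  rfl

@[simp] lemma leftHom_inr (a : A) : leftHom A (inr unitObj A a) = a := by
  rw [inr_eq_tmul, leftHom_tmul, map_one, one_smul]

/-- The map `a ⊗ z ↦ z • a`. -/
noncomputable def rightHom (A : CPureRep.{u}) : tens A unitObj ⟶ A := lift (𝟙 A) (unitHom A)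

@[simp] lemma rightHom_tmul (z : unitObj.{u}) (a : A) : rightHom A (tmul a z) = ofUnit z • a := by
  rw [rightHom, lift_tmul, unitHom_apply, Algebra.smul_def, mul_comm]
  rfl

@[simp] lemma rightHom_inl (a : A) : rightHom A (inl A unitObj a) = a := by
  rw [inl_eq_tmul, rightHom_tmul, map_one, one_smul]

/-- The map `a ⊗ b ↦ b ⊗ a`. -/
noncomputable def braidHom (A B : CPureRep.{u}) : tens A B ⟶ tens B A :=
  lift (inrHom B A) (inlHom B A)

@[simp] lemma braidHom_tmul (a : A) (b : B) : braidHom A B (tmul a b) = tmul b a := by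
  rw [braidHom, lift_tmul, inlHom_apply, inrHom_apply, tmul_def, mul_comm]

/-- The multiplication `a ⊗ b ↦ a * b`. -/
noncomputable def mulHom (A : CPureRep.{u}) : tens A A ⟶ A := lift (𝟙 A) (𝟙 A)

@[simp] lemma mulHom_tmul (a b : A) : mulHom A (tmul a b) = a * b := lift_tmul _ _ a b

@[simp] lemma hom_map_smul (f : A ⟶ B) (c : ℂ) (a : A) : f (c • a) = c • f a :=
  map_smul (toLin f) c a

/-! ### The symmetric monoidal structure -/

/-- The structure maps are lifts of explicit morphisms, and the inverse unitors are the inclusions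
of factors, so composites can be computed on elementary tensors. -/
noncomputable instance : MonoidalCategoryStruct CPureRep.{u} where
  tensorObj := tens
  whiskerLeft A _ _ f := tensHom (𝟙 A) f
  whiskerRight f B := tensHom f (𝟙 B)
  tensorHom := tensHom
  tensorUnit := unitObj
  associator A B C :=
    { hom := assocHom A B C
      inv := assocInv A B C
      hom_inv_id := hom_ext_tmul_left fun a b c => by
        simp only [CategoryTheory.comp_apply, CategoryTheory.id_apply, assocHom_tmul, assocInv_tmul]
      inv_hom_id := hom_ext_tmul_right fun a b c => by
        simp only [CategoryTheory.comp_apply, CategoryTheory.id_apply, assocHom_tmul,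
          assocInv_tmul] }
  leftUnitor A :=
    { hom := leftHom A
      inv := inrHom unitObj A
      hom_inv_id := hom_ext_tmul fun z a => by
        simp only [CategoryTheory.comp_apply, CategoryTheory.id_apply, inrHom_apply, map_smul, tmul_unit_left,
          leftHom_inr]
      inv_hom_id := hom_ext fun a => by
        simp only [CategoryTheory.comp_apply, CategoryTheory.id_apply, leftHom_inr, inrHom_apply] }
  rightUnitor A :=
    { hom := rightHom A
      inv := inlHom A unitObj
      hom_inv_id := hom_ext_tmul fun a z => by
        simp only [CategoryTheory.comp_apply, CategoryTheory.id_apply, inlHom_apply, map_smul, tmul_unit_right,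
          rightHom_inl]
      inv_hom_id := hom_ext fun a => by
        simp only [CategoryTheory.comp_apply, CategoryTheory.id_apply, rightHom_inl,
          inlHom_apply] }

lemma tensHom_id_id (A B : CPureRep.{u}) : tensHom (𝟙 A) (𝟙 B) = 𝟙 (tens A B) :=
  hom_ext_tmul fun a b => by
    simp only [tensHom_tmul, CategoryTheory.id_apply]

lemma tensHom_comp {A₁ A₂ A₃ B₁ B₂ B₃ : CPureRep.{u}} (f₁ : A₁ ⟶ A₂) (f₂ : B₁ ⟶ B₂)
    (g₁ : A₂ ⟶ A₃) (g₂ : B₂ ⟶ B₃) :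
    tensHom f₁ f₂ ≫ tensHom g₁ g₂ = tensHom (f₁ ≫ g₁) (f₂ ≫ g₂) :=
  hom_ext_tmul fun a b => by
    simp only [tensHom_tmul, CategoryTheory.comp_apply]

lemma tensHom_assocHom {A₁ A₂ B₁ B₂ C₁ C₂ : CPureRep.{u}} (f : A₁ ⟶ A₂) (g : B₁ ⟶ B₂)
    (h : C₁ ⟶ C₂) : tensHom (tensHom f g) h ≫ assocHom A₂ B₂ C₂ =
      assocHom A₁ B₁ C₁ ≫ tensHom f (tensHom g h) :=
  hom_ext_tmul_left fun a b c => by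
    simp only [tensHom_tmul, CategoryTheory.comp_apply, assocHom_tmul]

lemma tensHom_leftHom (f : A ⟶ B) :
    tensHom (𝟙 unitObj) f ≫ leftHom B = leftHom A ≫ f :=
  hom_ext_tmul fun z a => by
    simp only [tensHom_tmul, CategoryTheory.comp_apply, CategoryTheory.id_apply, leftHom_tmul,
      hom_map_smul]

lemma tensHom_rightHom (f : A ⟶ B) :
    tensHom f (𝟙 unitObj) ≫ rightHom B = rightHom A ≫ f :=
  hom_ext_tmul fun a z => by
    simp only [tensHom_tmul, CategoryTheory.comp_apply, CategoryTheory.id_apply, rightHom_tmul,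
      hom_map_smul]

lemma assocHom_pentagon (A B C D : CPureRep.{u}) :
    tensHom (assocHom A B C) (𝟙 D) ≫ assocHom A (tens B C) D ≫ tensHom (𝟙 A) (assocHom B C D) =
      assocHom (tens A B) C D ≫ assocHom A B (tens C D) :=
  hom_ext_tmul_left_left fun a b c d => by
    simp only [tensHom_tmul, CategoryTheory.comp_apply, CategoryTheory.id_apply, assocHom_tmul]

lemma assocHom_triangle (A B : CPureRep.{u}) :
    assocHom A unitObj B ≫ tensHom (𝟙 A) (leftHom B) = tensHom (rightHom A) (𝟙 B) :=
  hom_ext_tmul_left fun a z b => by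
    simp only [tensHom_tmul, CategoryTheory.comp_apply, CategoryTheory.id_apply, assocHom_tmul,
      leftHom_tmul, rightHom_tmul, smul_tmul, tmul_smul]

noncomputable instance : MonoidalCategory CPureRep.{u} :=
  MonoidalCategory.ofTensorHom tensHom_id_id (fun _ _ _ _ => rfl) (fun _ _ => rfl) tensHom_comp
    tensHom_assocHom tensHom_leftHom tensHom_rightHom assocHom_pentagon assocHom_triangle

lemma tensHom_braidHom (f : A ⟶ A') (g : B ⟶ B') :
    tensHom f g ≫ braidHom A' B' = braidHom A B ≫ tensHom g f :=
  hom_ext_tmul fun a b => by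
    simp only [tensHom_tmul, CategoryTheory.comp_apply, braidHom_tmul]

lemma braidHom_braidHom (A B : CPureRep.{u}) : braidHom A B ≫ braidHom B A = 𝟙 (tens A B) :=
  hom_ext_tmul fun a b => by
    simp only [CategoryTheory.comp_apply, CategoryTheory.id_apply, braidHom_tmul]

lemma braidHom_hexagon_forward (A B C : CPureRep.{u}) :
    assocHom A B C ≫ braidHom A (tens B C) ≫ assocHom B C A =
      tensHom (braidHom A B) (𝟙 C) ≫ assocHom B A C ≫ tensHom (𝟙 B) (braidHom A C) :=
  hom_ext_tmul_left fun a b c => by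
    simp only [tensHom_tmul, CategoryTheory.comp_apply, CategoryTheory.id_apply, assocHom_tmul,
      braidHom_tmul]

lemma braidHom_hexagon_reverse (A B C : CPureRep.{u}) :
    assocInv A B C ≫ braidHom (tens A B) C ≫ assocInv C A B =
      tensHom (𝟙 A) (braidHom B C) ≫ assocInv A C B ≫ tensHom (braidHom A C) (𝟙 B) :=
  hom_ext_tmul_right fun a b c => by
    simp only [tensHom_tmul, CategoryTheory.comp_apply, CategoryTheory.id_apply, assocInv_tmul,
      braidHom_tmul]

noncomputable instance : SymmetricCategory CPureRep.{u} where
  braiding A B := ⟨braidHom A B, braidHom B A, braidHom_braidHom A B, braidHom_braidHom B A⟩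
  braiding_naturality_right A _ _ f := tensHom_braidHom (𝟙 A) f
  braiding_naturality_left f B := tensHom_braidHom f (𝟙 B)
  hexagon_forward := braidHom_hexagon_forward
  hexagon_reverse := braidHom_hexagon_reverse
  symmetry := braidHom_braidHom

/-- The inclusions of the factors into the tensor products. -/
noncomputable def tensorInclusions : TensorInclusions.{u} := ⟨inl, inr⟩

lemma isRegularMonoidal : IsRegularMonoidal tensorInclusions.{u} where
  isRegularTensorProduct _ _ := isRegularTensorProduct
  unit := bijective_algebraMap_unitObj
  tensorHom f g a b := tensHom_tmul f g a b
  associator a b c := assocHom_tmul a b c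
  leftUnitor z a := (leftHom_tmul (algebraMap ℂ unitObj z) a).trans
    (congrArg (· • a) (ofUnit_algebraMap.{u} z))
  rightUnitor z a := (rightHom_tmul (algebraMap ℂ unitObj z) a).trans
    (congrArg (· • a) (ofUnit_algebraMap.{u} z))
  braiding a b := braidHom_tmul a b

end CPureRep

/-! ### The monoidal structure of `Stoch` acting on functions -/

section KoopTensor

variable {X X' Y Y' Z : Stoch.{u}}

/-- The function `(x, y) ↦ f x * g y` on the product of two objects of `Stoch`. -/
noncomputable def boxMul (f : LInfty X.obj) (g : LInfty Y.obj) : LInfty (X ⊗ Y).obj :=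
  LInfty.prodMul f g

-- The whiskered kernel is at each point a product with a Dirac measure, so the integral factors.
@[simp] lemma koop_whiskerRight (κ : X ⟶ X') (f : LInfty X'.obj) (g : LInfty Y.obj) :
    koop (κ ▷ Y) (boxMul f g) = boxMul (koop κ f) g := by
  refine LInfty.ext fun p => ?_
  change ∫ q : X'.obj × Y.obj, f q.1 * g q.2 ∂((κ.hom.hom ∥ₖ Kernel.id) p) =
    (∫ x, f x ∂(κ.hom.hom p.1)) * g p.2
  rw [Kernel.parallelComp_apply, integral_prod_mul (fun x => f x) (fun y => g y), Kernel.id_apply,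
    LInfty.integral_dirac_eq]

@[simp] lemma koop_whiskerLeft (κ : Y ⟶ Y') (f : LInfty X.obj) (g : LInfty Y'.obj) :
    koop (X ◁ κ) (boxMul f g) = boxMul f (koop κ g) := by
  refine LInfty.ext fun p => ?_
  change ∫ q : X.obj × Y'.obj, f q.1 * g q.2 ∂((Kernel.id ∥ₖ κ.hom.hom) p) =
    f p.1 * ∫ y, g y ∂(κ.hom.hom p.2)
  rw [Kernel.parallelComp_apply, integral_prod_mul (fun x => f x) (fun y => g y), Kernel.id_apply,
    LInfty.integral_dirac_eq]

@[simp] lemma koop_associator (f : LInfty X.obj) (g : LInfty Y.obj) (h : LInfty Z.obj) :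
    koop (α_ X Y Z).hom (boxMul f (boxMul g h)) = boxMul (boxMul f g) h :=
  LInfty.ext fun p => (koop_stochDet (X := (X ⊗ Y) ⊗ Z) (Y := X ⊗ Y ⊗ Z)
    MeasurableEquiv.prodAssoc (MeasurableEquiv.measurable _) _ p).trans (mul_assoc _ _ _).symm

@[simp] lemma koop_leftUnitor_inv (f : LInfty (𝟙_ Stoch.{u}).obj) (g : LInfty X.obj) :
    koop (λ_ X).inv (boxMul f g) = f PUnit.unit • g := by
  have hm : Measurable fun x : X.obj => (PUnit.unit.{u + 1}, x) := by fun_prop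
  refine LInfty.ext fun x => ?_
  -- The inverse unitor is the image of the identity kernel under `x ↦ (*, x)`, that is, a
  -- deterministic kernel.
  change ∫ q : PUnit × X.obj, (boxMul f g : LInfty (𝟙_ Stoch.{u} ⊗ X).obj) q
    ∂(Kernel.id.map (fun x : X.obj => (PUnit.unit.{u + 1}, x)) x) = _
  rw [Kernel.id_map hm, Kernel.deterministic_apply]
  exact LInfty.integral_dirac_eq _ _

@[simp] lemma koop_rightUnitor_inv (f : LInfty X.obj) (g : LInfty (𝟙_ Stoch.{u}).obj) :
    koop (ρ_ X).inv (boxMul f g) = g PUnit.unit • f := by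
  have hm : Measurable fun x : X.obj => (x, PUnit.unit.{u + 1}) := by fun_prop
  refine LInfty.ext fun x => ?_
  change ∫ q : X.obj × PUnit, (boxMul f g : LInfty (X ⊗ 𝟙_ Stoch.{u}).obj) q
    ∂(Kernel.id.map (fun x : X.obj => (x, PUnit.unit.{u + 1})) x) = _
  rw [Kernel.id_map hm, Kernel.deterministic_apply]
  exact (LInfty.integral_dirac_eq _ _).trans (mul_comm _ _)

@[simp] lemma koop_braiding (f : LInfty X.obj) (g : LInfty Y.obj) :
    koop (β_ X Y).hom (boxMul g f) = boxMul f g :=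
  LInfty.ext fun p => (koop_stochDet (X := X ⊗ Y) (Y := Y ⊗ X) Prod.swap measurable_swap _ p).trans
    (mul_comm _ _)

@[simp] lemma koop_comul (f g : LInfty X.obj) : koop Δ[X] (boxMul f g) = f * g :=
  LInfty.ext fun x => koop_stochDet (X := X) (Y := X ⊗ X) (fun x => (x, x)) (by fun_prop) _ x

@[simp] lemma koop_counit (f : LInfty (𝟙_ Stoch.{u}).obj) :
    koop ε[X] f = algebraMap ℂ _ (f PUnit.unit) :=
  LInfty.ext fun x => koop_stochDet (X := X) (Y := 𝟙_ Stoch.{u}) (fun _ => PUnit.unit)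
    (by fun_prop) _ x

end KoopTensor

/-! ### Compatibility of `𝓛^∞` with the tensor products -/

namespace CPureRep

variable {X X' Y Y' Z : Stoch.{u}}

/-- The algebra `𝓛^∞(X)` of an object of `Stoch`. -/
noncomputable abbrev funObj (X : Stoch.{u}) : CPureRep.{u} := (LInftyFunctor.obj X).unop

/-- The morphism `f ↦ f ∘ Prod.fst`. -/
noncomputable def fstHom (X Y : Stoch.{u}) : funObj X ⟶ funObj (X ⊗ Y) :=
  koop (stochDet (X := X ⊗ Y) (Y := X) Prod.fst measurable_fst)

/-- The morphism `g ↦ g ∘ Prod.snd`. -/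
noncomputable def sndHom (X Y : Stoch.{u}) : funObj Y ⟶ funObj (X ⊗ Y) :=
  koop (stochDet (X := X ⊗ Y) (Y := Y) Prod.snd measurable_snd)

/-- The morphism `f ⊗ g ↦ ((x, y) ↦ f x * g y)`. -/
noncomputable def boxHom (X Y : Stoch.{u}) : tens (funObj X) (funObj Y) ⟶ funObj (X ⊗ Y) :=
  lift (fstHom X Y) (sndHom X Y)

@[simp] lemma boxHom_tmul (f : funObj X) (g : funObj Y) :
    boxHom X Y (tmul f g) = toObj (boxMul (ofObj f) (ofObj g)) :=
  (lift_tmul (fstHom X Y) (sndHom X Y) f g).trans <| LInfty.ext (X := X.obj × Y.obj) fun p =>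
    congrArg₂ (· * ·) (koop_stochDet (X := X ⊗ Y) (Y := X) _ _ f p)
      (koop_stochDet (X := X ⊗ Y) (Y := Y) _ _ g p)

/-- The inverse of `boxHom`. -/
noncomputable def boxInv (X Y : Stoch.{u}) : funObj (X ⊗ Y) ⟶ tens (funObj X) (funObj Y) :=
  prodLift (X := X.obj) (Y := Y.obj) (inlHom (funObj X) (funObj Y)) (inrHom (funObj X) (funObj Y))

@[simp] lemma boxInv_boxMul (f : LInfty X.obj) (g : LInfty Y.obj) :
    boxInv X Y (toObj (boxMul f g)) = tmul (toObj f) (toObj g) :=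
  prodLift_prodMul (X := X.obj) (Y := Y.obj) (inlHom (funObj X) (funObj Y))
    (inrHom (funObj X) (funObj Y)) f g

lemma hom_ext_boxMul {C : CPureRep.{u}} {p q : funObj (X ⊗ Y) ⟶ C}
    (h : ∀ (f : LInfty X.obj) (g : LInfty Y.obj),
      p (toObj (boxMul f g)) = q (toObj (boxMul f g))) : p = q :=
  hom_ext fun t => LinearMap.congr_fun (SigmaContinuous.ext_prodMul (X := X.obj) (Y := Y.obj)
    (sigmaContinuous_toLin p) (sigmaContinuous_toLin q) h) t

/-- The isomorphism between the regular tensor product of `𝓛^∞(X)` and `𝓛^∞(Y)` and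
`𝓛^∞(X × Y)`. -/
noncomputable def boxIso (X Y : Stoch.{u}) : tens (funObj X) (funObj Y) ≅ funObj (X ⊗ Y) where
  hom := boxHom X Y
  inv := boxInv X Y
  hom_inv_id := hom_ext_tmul fun f g => by
    simp only [CategoryTheory.comp_apply, CategoryTheory.id_apply, boxHom_tmul, boxInv_boxMul,
      toObj_ofObj]
  inv_hom_id := hom_ext_boxMul fun f g => by
    simp only [CategoryTheory.comp_apply, CategoryTheory.id_apply, boxHom_tmul, boxInv_boxMul,
      ofObj_toObj]

/-- The action of a morphism of `Stoch` on algebras of bounded measurable functions. -/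
noncomputable abbrev mapHom (κ : X ⟶ Y) : funObj Y ⟶ funObj X := (LInftyFunctor.map κ).unop

lemma tensHom_mapHom_left (κ : X ⟶ X') (Y : Stoch.{u}) :
    tensHom (mapHom κ) (𝟙 (funObj Y)) ≫ boxHom X Y = boxHom X' Y ≫ mapHom (κ ▷ Y) :=
  hom_ext_tmul fun f g => by
    simp only [CategoryTheory.comp_apply, CategoryTheory.id_apply, boxHom_tmul, tensHom_tmul,
      map_unop_apply, ofObj_toObj, koop_whiskerRight]

lemma tensHom_mapHom_right (X : Stoch.{u}) (κ : Y ⟶ Y') :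
    tensHom (𝟙 (funObj X)) (mapHom κ) ≫ boxHom X Y = boxHom X Y' ≫ mapHom (X ◁ κ) :=
  hom_ext_tmul fun f g => by
    simp only [CategoryTheory.comp_apply, CategoryTheory.id_apply, boxHom_tmul, tensHom_tmul,
      map_unop_apply, ofObj_toObj, koop_whiskerLeft]

/-- The associator of the opposite category is the inverse associator reversed, hence `assocInv` and
tensors bracketed to the right. -/
lemma assocInv_boxHom (X Y Z : Stoch.{u}) :
    (assocInv (funObj X) (funObj Y) (funObj Z) ≫ tensHom (boxHom X Y) (𝟙 (funObj Z))) ≫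
      boxHom (X ⊗ Y) Z =
    (tensHom (𝟙 (funObj X)) (boxHom Y Z) ≫ boxHom X (Y ⊗ Z)) ≫ mapHom (α_ X Y Z).hom :=
  hom_ext_tmul_right fun f g h => by
    simp only [CategoryTheory.comp_apply, CategoryTheory.id_apply, boxHom_tmul, tensHom_tmul,
      map_unop_apply, ofObj_toObj, koop_associator, assocInv_tmul]

lemma leftHom_boxHom (X : Stoch.{u}) :
    leftHom (funObj X) = boxHom (𝟙_ Stoch.{u}) X ≫ mapHom (λ_ X).inv :=
  hom_ext_tmul fun z f => by
    rw [leftHom_tmul]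
    exact ((congrArg (mapHom (λ_ X).inv) (boxHom_tmul (X := 𝟙_ Stoch.{u}) z f)).trans
      (koop_leftUnitor_inv (ofObj (X := 𝟙_ Stoch.{u}) z) (ofObj f))).symm

lemma rightHom_boxHom (X : Stoch.{u}) :
    rightHom (funObj X) = boxHom X (𝟙_ Stoch.{u}) ≫ mapHom (ρ_ X).inv :=
  hom_ext_tmul fun f z => by
    rw [rightHom_tmul]
    exact ((congrArg (mapHom (ρ_ X).inv) (boxHom_tmul (Y := 𝟙_ Stoch.{u}) f z)).trans
      (koop_rightUnitor_inv (ofObj f) (ofObj (X := 𝟙_ Stoch.{u}) z))).symm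

lemma braidHom_boxHom (X Y : Stoch.{u}) :
    braidHom (funObj X) (funObj Y) ≫ boxHom Y X = boxHom X Y ≫ mapHom (β_ Y X).hom :=
  hom_ext_tmul fun f g => by
    simp only [CategoryTheory.comp_apply, boxHom_tmul, braidHom_tmul, map_unop_apply, ofObj_toObj,
      koop_braiding]

/-- The unit object is `𝓛^∞` of a point, so the unit comparison is an identity; its whiskering is
removed from the unit laws by this equation. -/
lemma tensHom_id_comp {A B C : CPureRep.{u}} (f : tens A B ⟶ C) :
    tensHom (𝟙 A) (𝟙 B) ≫ f = f := by
  rw [tensHom_id_id, Category.id_comp]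

end CPureRep

open CPureRep

/-- The symmetric monoidal structure of the functor `𝓛^∞`. -/
noncomputable def linftyCoreMonoidal : LInftyFunctor.{u}.CoreMonoidal :=
  .mk' (Iso.refl _) (fun X Y => (boxIso X Y).symm.op)
    (fun f X' => Quiver.Hom.unop_inj (tensHom_mapHom_left f X'))
    (fun X' f => Quiver.Hom.unop_inj (tensHom_mapHom_right X' f))
    (fun X Y Z => Quiver.Hom.unop_inj (assocInv_boxHom X Y Z))
    (fun X => Quiver.Hom.unop_inj ((leftHom_boxHom X).trans
      (congrArg (· ≫ mapHom (λ_ X).inv) (tensHom_id_comp (boxHom (𝟙_ Stoch.{u}) X)).symm)))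
    (fun X => Quiver.Hom.unop_inj ((rightHom_boxHom X).trans
      (congrArg (· ≫ mapHom (ρ_ X).inv) (tensHom_id_comp (boxHom X (𝟙_ Stoch.{u}))).symm)))

noncomputable instance : LInftyFunctor.{u}.Monoidal := linftyCoreMonoidal.toMonoidal

noncomputable instance : LInftyFunctor.{u}.Braided where
  braided X Y := by
    -- Passing from `μ` to its inverse `δ` replaces `boxInv` by `boxHom`, which is explicit on
    -- elementary tensors.
    rw [← cancel_epi (Functor.OplaxMonoidal.δ LInftyFunctor X Y),
      ← cancel_mono (Functor.OplaxMonoidal.δ LInftyFunctor Y X)]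
    simp only [Category.assoc, Functor.Monoidal.δ_μ_assoc, Functor.Monoidal.μ_δ, Category.comp_id]
    exact Quiver.Hom.unop_inj (braidHom_boxHom Y X).symm

open CPureRep

/-! ### The Markov category structure -/

namespace CPureRep

/-- Reversing arrows, the comonoid laws are the unit and associativity laws of the multiplication.
-/
noncomputable instance (A : CPureRep.{u}ᵒᵖ) : ComonObj A where
  counit := (unitHom A.unop).op
  comul := (mulHom A.unop).op
  counit_comul := Quiver.Hom.unop_inj <| hom_ext_tmul fun z a => by
    change mulHom A.unop (tensHom (unitHom A.unop) (𝟙 A.unop) (tmul z a)) = leftHom A.unop (tmul z a)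
    rw [tensHom_tmul, mulHom_tmul, leftHom_tmul, unitHom_apply, Algebra.smul_def]
    rfl
  comul_counit := Quiver.Hom.unop_inj <| hom_ext_tmul fun a z => by
    change mulHom A.unop (tensHom (𝟙 A.unop) (unitHom A.unop) (tmul a z)) =
      rightHom A.unop (tmul a z)
    rw [tensHom_tmul, mulHom_tmul, rightHom_tmul, unitHom_apply, Algebra.smul_def, mul_comm]
    rfl
  comul_assoc := Quiver.Hom.unop_inj <| hom_ext_tmul_right fun a b c => by
    change mulHom A.unop (tensHom (𝟙 A.unop) (mulHom A.unop) (tmul a (tmul b c))) =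
      mulHom A.unop (tensHom (mulHom A.unop) (𝟙 A.unop) (assocInv _ _ _ (tmul a (tmul b c))))
    rw [assocInv_tmul, tensHom_tmul, tensHom_tmul, mulHom_tmul, mulHom_tmul, mulHom_tmul,
      mulHom_tmul, CategoryTheory.id_apply, CategoryTheory.id_apply, mul_assoc]

instance (A : CPureRep.{u}ᵒᵖ) : IsCommComonObj A where
  comul_comm := Quiver.Hom.unop_inj <| hom_ext_tmul fun a b => by
    change mulHom A.unop (braidHom A.unop A.unop (tmul a b)) = mulHom A.unop (tmul a b)
    rw [braidHom_tmul, mulHom_tmul, mulHom_tmul, mul_comm]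

noncomputable instance : SymmetricCategory CPureRep.{u}ᵒᵖ where
  symmetry A B := Quiver.Hom.unop_inj (braidHom_braidHom A.unop B.unop)

/-- Interchanging the middle factors is what relates the multiplication of a tensor product to the
multiplications of its factors. -/
lemma tensorμ_tmul {A A' B B' : CPureRep.{u}} (a : A) (b : B) (a' : A') (b' : B') :
    tensorμ A B A' B' (tmul (tmul a b) (tmul a' b')) = tmul (tmul a a') (tmul b b') := by
  change assocInv A A' (tens B B') (tensHom (𝟙 A) (assocHom A' B B')
    (tensHom (𝟙 A) (tensHom (braidHom B A') (𝟙 B')) (tensHom (𝟙 A) (assocInv B A' B')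
      (assocHom A B (tens A' B') (tmul (tmul a b) (tmul a' b')))))) = _
  simp only [assocHom_tmul, tensHom_tmul, assocInv_tmul, braidHom_tmul, CategoryTheory.id_apply]

/-- Copying respects tensor products because elementary tensors multiply componentwise; discarding
is natural because morphisms are linear and unital. -/
noncomputable instance : MarkovCategory CPureRep.{u}ᵒᵖ where
  copy_tensor A B := Quiver.Hom.unop_inj <| (hom_ext_tmul_tmul fun a b a' b' => by
    change mulHom (tens A.unop B.unop) (tmul (tmul a b) (tmul a' b')) =
      tensHom (mulHom A.unop) (mulHom B.unop)
        ((tensorμ A A B B).unop (tmul (tmul a b) (tmul a' b')))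
    rw [BraidedCategory.unop_tensorμ]
    refine Eq.trans ?_ (congrArg _ (tensorμ_tmul a b a' b').symm)
    rw [mulHom_tmul, tmul_mul_tmul, tensHom_tmul, mulHom_tmul, mulHom_tmul])
  discard_tensor A B := Quiver.Hom.unop_inj <| hom_ext fun z => by
    change unitHom (tens A.unop B.unop) z =
      tensHom (unitHom A.unop) (unitHom B.unop) (inr unitObj unitObj z)
    rw [tensHom_inr, unitHom_apply, unitHom_apply, AlgHomClass.commutes]
  copy_unit := Quiver.Hom.unop_inj <| hom_ext_tmul fun z w => by
    change mulHom unitObj (tmul z w) = leftHom unitObj (tmul z w)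
    rw [mulHom_tmul, leftHom_tmul, Algebra.smul_def, algebraMap_ofUnit]
  discard_unit := Quiver.Hom.unop_inj <| hom_ext fun z => algebraMap_ofUnit z
  discard_natural {A B} f := Quiver.Hom.unop_inj <| hom_ext fun z => by
    change f.unop (unitHom B.unop z) = unitHom A.unop z
    rw [unitHom_apply, Algebra.algebraMap_eq_smul_one, hom_map_smul, hom_map_one, unitHom_apply,
      Algebra.algebraMap_eq_smul_one]

lemma isAlgebraicMarkov :
    IsAlgebraicMarkov tensorInclusions.{u} (inferInstance : MarkovCategory CPureRep.{u}ᵒᵖ) where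
  braiding _ _ := rfl
  copy a b := mulHom_tmul a b
  discard {A} z := congrArg (algebraMap ℂ A) (ofUnit_algebraMap.{u} z)

/-- Copying is the Dirac kernel of the diagonal, and restricting `(x, y) ↦ f x * g y` to the
diagonal multiplies the functions. -/
lemma boxHom_comul (X : Stoch.{u}) : boxHom X X ≫ mapHom Δ[X] = mulHom (funObj X) :=
  hom_ext_tmul fun f g => by
    rw [mulHom_tmul]
    simp only [CategoryTheory.comp_apply, boxHom_tmul, map_unop_apply, ofObj_toObj, koop_comul]
    rfl

lemma mapHom_counit (X : Stoch.{u}) : mapHom ε[X] = unitHom (funObj X) :=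
  hom_ext fun z => koop_counit (ofObj (X := 𝟙_ Stoch.{u}) z)

end CPureRep

/-! ### The inverse of a braided equivalence -/

section InverseBraided

open Functor.LaxMonoidal Functor.OplaxMonoidal

variable {𝒞 𝒟 : Type*} [Category* 𝒞] [Category* 𝒟] [MonoidalCategory 𝒞] [MonoidalCategory 𝒟]
  [BraidedCategory 𝒞] [BraidedCategory 𝒟]

/-- The right adjoint of a braided functor is compatible with the braidings. -/
lemma rightAdjoint_braided {F : 𝒞 ⥤ 𝒟} {G : 𝒟 ⥤ 𝒞} (adj : F ⊣ G) [F.Braided] [G.LaxMonoidal]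
    [adj.IsMonoidal] (X Y : 𝒟) :
    μ G X Y ≫ G.map (β_ X Y).hom = (β_ (G.obj X) (G.obj Y)).hom ≫ μ G Y X := by
  -- After transposition, the tensorator of `G` is expressed through that of `F` and the counit;
  -- naturality of the braiding and braidedness of `F` remain.
  apply (adj.homEquiv _ _).symm.injective
  simp only [Adjunction.homEquiv_counit, Functor.map_comp, Category.assoc,
    Adjunction.map_μ_comp_counit_app_tensor]
  rw [Adjunction.counit_naturality, Adjunction.map_μ_comp_counit_app_tensor_assoc]
  simp

end InverseBraided

noncomputable instance : stochEquivalence.{u}.functor.Braided :=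
  inferInstanceAs LInftyFunctor.{u}.Braided

noncomputable instance : sigmaSpecAction.{u}.functor.Monoidal := stochEquivalence.inverseMonoidal

noncomputable instance : stochEquivalence.{u}.inverse.Monoidal :=
  stochEquivalence.inverseMonoidal

/-- The monoidal structure of the inverse is defined by transport along this very adjunction, so
compatibility is definitional. -/
instance : stochEquivalence.{u}.IsMonoidal where
  leftAdjoint_ε := rfl
  leftAdjoint_μ _ _ := rfl

noncomputable instance : sigmaSpecAction.{u}.functor.Braided where
  braided X Y := rightAdjoint_braided stochEquivalence.toAdjunction X Y

end SigmaCStar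

theorem proposition5p5 :
    ∃ (S : SigmaSpecAction.{u})
      (unitIso : 𝟭 Stoch.{u} ≅ LInftyFunctor.{u} ⋙ S.functor)
      (counitIso : S.functor ⋙ LInftyFunctor.{u} ≅ 𝟭 CPureRep.{u}ᵒᵖ)
      (triangle : ∀ X : Stoch.{u},
        LInftyFunctor.map (unitIso.hom.app X) ≫ counitIso.hom.app (LInftyFunctor.obj X) = 𝟙 _),
      -- the unit is given by the Dirac measures at the evaluations,
      -- the counit by the Gelfand transform
      (∀ (X : Stoch.{u}) (x : X.obj),
        (unitIso.hom.app X).hom.hom x = Measure.dirac (evalPoint x)) ∧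
      (∀ (A : CPureRep.{u}) (a : A) (φ : SigmaSpec A),
        linftyEval (X := specObj A) ((counitIso.hom.app (op A)).unop a) φ = φ a) ∧
      -- the equivalence is symmetric monoidal for the regular tensor product
      ∃ (_ : MonoidalCategory CPureRep.{u}) (_ : SymmetricCategory CPureRep.{u})
        (T : TensorInclusions.{u}) (_ : LInftyFunctor.{u}.Braided) (_ : S.functor.Braided),
        IsRegularMonoidal T ∧
        (Equivalence.mk' LInftyFunctor S.functor unitIso counitIso triangle).IsMonoidal ∧
        (∀ (X Y : Stoch.{u}) (f : (LInftyFunctor.obj X).unop) (g : (LInftyFunctor.obj Y).unop)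
          (x : X.obj) (y : Y.obj),
          linftyEval (X := X ⊗ Y) ((Functor.OplaxMonoidal.δ LInftyFunctor X Y).unop (T.tmul f g)) (x, y) =
            linftyEval f x * linftyEval g y) ∧
        -- and it is an equivalence of Markov categories
        ∃ K : MarkovCategory CPureRep.{u}ᵒᵖ, IsAlgebraicMarkov T K ∧
          (∀ X : Stoch.{u}, LInftyFunctor.map Δ[X] ≫ Functor.OplaxMonoidal.δ LInftyFunctor X X =
            (K.comonObj (LInftyFunctor.obj X)).comul) ∧
          (∀ X : Stoch.{u}, LInftyFunctor.map ε[X] ≫ Functor.OplaxMonoidal.η LInftyFunctor =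
            (K.comonObj (LInftyFunctor.obj X)).counit) := by
  refine ⟨sigmaSpecAction, evalIso, gelfandNatIso, evalIso_gelfandNatIso_triangle,
    evalIso_hom_app_apply, linftyEval_gelfandNatIso, inferInstance, inferInstance,
    CPureRep.tensorInclusions, inferInstance, inferInstance, CPureRep.isRegularMonoidal,
    inferInstanceAs stochEquivalence.IsMonoidal, fun X Y f g x y => ?_, inferInstance,
    CPureRep.isAlgebraicMarkov, fun X => Quiver.Hom.unop_inj (CPureRep.boxHom_comul X),
    fun X => Quiver.Hom.unop_inj ?_⟩
  · exact congrArg (fun h => linftyEval (X := X ⊗ Y) h (x, y)) (CPureRep.boxHom_tmul f g)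
  -- The comparison `η` is the identity, since the unit object is `𝓛^∞` of a point.
  · exact (Category.id_comp _).trans (CPureRep.mapHom_counit X)
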